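/- Let $\Lambda$ be a topological space with a $\sigma$-algebra and a $\sigma$-finite measure $\mu$ (no relation between the topology, the $\sigma$-algebra and the measure is assumed). A quaternion means an element $q=s+x\mathbf i+y\mathbf j+z\mathbf k$ of the algebra $\mathbb Q_{\mathbb C}$ of complexified quaternions ($s,x,y,z\in\mathbb C$), and $q^*=s-x\mathbf i-y\mathbf j-z\mathbf k$, the complex coefficients not being conjugated. For an $n\times n$ quaternion matrix $X$ the Moore–Dyson determinant is $$\mathrm{Det}_M(X)=\sum_{\sigma\in S_n}\varepsilon(\sigma)\,(X_{n_1i_2}X_{i_2i_3}\cdots X_{i_sn_1})\cdots(X_{n_rk_2}X_{k_2k_3}\cdots X_{k_ln_r}),$$ where $\sigma=(n_1i_2\ldots i_s)\cdots(n_rk_2\ldots k_l)$ is written as a product of disjoint cycles (fixed points included) with $n_j$ the largest element of its cycle and $n_1>\cdots>n_r$, and $\varepsilon(\sigma)$ is the sign of $\sigma$. A quaternion kernel $K:\Lambda\times\Lambda\to\mathbb Q_{\mathbb C}$ is positive if $\mathrm{Det}_M(K(x_i,x_j))_{1\le i,j\le m}$ is a non-negative real number for all $m\ge1$ and all $x_1,\dots,x_m\in\Lambda$.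 Theorem. Let $K$ be a finite-rank quasi-real quaternion kernel, that is, $$K(x,y)=\sum_{k=1}^N\lambda_k\,u_k(x)\,u_k(y)^*\qquad(x,y\in\Lambda)$$ with $N<\infty$, real eigenvalues $\lambda_k$ and measurable functions $u_k:\Lambda\to\mathbb Q_{\mathbb C}$ such that each $u_k^*u_l$ is integrable (componentwise) and $\int_\Lambda u_k^*u_l\,d\mu=\delta_{kl}$. Suppose that $K$ is completely positive, that is, for every $I\subseteq\{1,\dots,N\}$ the kernel $\sum_{i\in I}u_i(x)u_i(y)^*$ is positive, and that all $\lambda_k\in[0,1]$. Then $K$ defines a Pfaffian point field: $K(y,x)=K(x,y)^*$, and there is a random point field on $\Lambda$, i.e. a probability measure on the space of countable configurations of points of $\Lambda$ (points may be repeated) that have finitely many points in every compact set, with the $\sigma$-algebra generated by the numbers $\#(A)$ of points in measurable sets $A$, such that for every $m\ge1$ the function $$R_m(x_1,\dots,x_m)=\mathrm{Det}_M\big(K(x_i,x_j)\big)_{1\le i,j\le m}$$ is real, non-negative and locally integrable on $\Lambda^m$ and is its $m$-point correlation function: for all disjoint measurable sets $A_1,\dots,A_p\subseteq\Lambda$ and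 all integers $k_1,\dots,k_p\ge0$ with $\sum_ik_i=m$, $$\mathbb E\prod_{i=1}^p\#(A_i)(\#(A_i)-1)\cdots(\#(A_i)-k_i+1)=\int_{A_1^{k_1}\times\cdots\times A_p^{k_p}}R_m\,d\mu^{\otimes m}.$$ -/

import Mathlib

open MeasureTheory
open scoped ENNReal

/-- Complexified quaternions `s + x i + y j + z k` with complex coefficients. The operation
`star` is the quaternion conjugate `s - x i - y j - z k`; the complex coefficients are not
conjugated. -/
abbrev CQuat : Type := Quaternion ℂ

noncomputable section

/-! ### The Moore–Dyson determinant -/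

/-- The elements of `Fin n` that are the largest in their cycle of `σ` (fixed points count as
cycles of length one), listed in decreasing order. -/
def cycleLeaders {n : ℕ} (σ : Equiv.Perm (Fin n)) : List (Fin n) :=
  open Classical in
  (List.finRange n).reverse.filter (fun a => decide (∀ b, σ.SameCycle a b → b ≤ a))

/-- The ordered product `X (a, σ a) * X (σ a, σ² a) * ⋯ * X (σ^(l-1) a, a)` along the cycle of
`σ` through `a`, where `l` is the length of that cycle. -/
def cycleProd {n : ℕ} (X : Matrix (Fin n) (Fin n) CQuat) (σ : Equiv.Perm (Fin n))
    (a : Fin n) : CQuat :=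
  ((List.range (Function.minimalPeriod σ a)).map
    (fun i => X ((σ ^ i) a) ((σ ^ (i + 1)) a))).prod

/-- The Moore–Dyson determinant: the signed sum over all permutations of the products over
cycles, each cycle starting with its largest element and the cycles being ordered by
decreasing largest element. -/
def mooreDet {n : ℕ} (X : Matrix (Fin n) (Fin n) CQuat) : CQuat :=
  ∑ σ : Equiv.Perm (Fin n),
    ((Equiv.Perm.sign σ : ℤˣ) : ℤ) • ((cycleLeaders σ).map (cycleProd X σ)).prod

/-! ### Quaternion kernels -/

section Kernels

variable {Λ : Type*}

/-- The matrix `(K (x i) (x j))`. -/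
def kernelMatrix (K : Λ → Λ → CQuat) {m : ℕ} (x : Fin m → Λ) : Matrix (Fin m) (Fin m) CQuat :=
  Matrix.of fun i j => K (x i) (x j)

/-- A self-dual kernel: `K(y, x) = K(x, y)^*`. -/
def IsSelfDualKernel (K : Λ → Λ → CQuat) : Prop :=
  ∀ x y, K y x = star (K x y)

/-- A positive kernel: all the determinants `Det_M (K (x i) (x j))` are non-negative real
numbers. -/
def IsPositiveKernel (K : Λ → Λ → CQuat) : Prop :=
  ∀ m : ℕ, 1 ≤ m → ∀ x : Fin m → Λ,
    ∃ r : ℝ, 0 ≤ r ∧ mooreDet (kernelMatrix K x) = ((r : ℂ) : CQuat)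

/-- The partial projection kernel `K_I(x, y) = ∑_{i ∈ I} u_i(x) u_i(y)^*`. -/
def partialKernel {ι : Type*} (u : ι → Λ → CQuat) (I : Finset ι) (x y : Λ) : CQuat :=
  ∑ i ∈ I, u i x * star (u i y)

/-- Complete positivity of the family of eigenfunctions: every partial projection kernel is
positive. -/
def IsCompletelyPositive {ι : Type*} (u : ι → Λ → CQuat) : Prop :=
  ∀ I : Finset ι, IsPositiveKernel (partialKernel u I)

variable [MeasurableSpace Λ]

/-- A quaternion function is measurable when its four complex components are. -/
structure QuatMeasurable (f : Λ → CQuat) : Prop where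
  re : Measurable fun x => (f x).re
  imI : Measurable fun x => (f x).imI
  imJ : Measurable fun x => (f x).imJ
  imK : Measurable fun x => (f x).imK

/-- The four components of `f` are `μ`-integrable and the (componentwise) integral of `f`
is `q`. -/
structure HasQuatIntegral (μ : Measure Λ) (f : Λ → CQuat) (q : CQuat) : Prop where
  integrable_re : Integrable (fun x => (f x).re) μ
  integrable_imI : Integrable (fun x => (f x).imI) μ
  integrable_imJ : Integrable (fun x => (f x).imJ) μ
  integrable_imK : Integrable (fun x => (f x).imK) μ
  integral_re : ∫ x, (f x).re ∂μ = q.re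
  integral_imI : ∫ x, (f x).imI ∂μ = q.imI
  integral_imJ : ∫ x, (f x).imJ ∂μ = q.imJ
  integral_imK : ∫ x, (f x).imK ∂μ = q.imK

/-- An orthonormal system of quaternion functions: `∫ u_k^* u_l dμ = δ_{kl}`. -/
structure IsOrthonormalSystem {ι : Type*} [DecidableEq ι] (μ : Measure Λ)
    (u : ι → Λ → CQuat) : Prop where
  measurable : ∀ k, QuatMeasurable (u k)
  hasIntegral : ∀ k l,
    HasQuatIntegral μ (fun x => star (u k x) * u l x) (if k = l then 1 else 0)

/-- A finite-rank diagonal form `K(x, y) = ∑_k λ_k u_k(x) u_k(y)^*` with scalar eigenvalues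
`λ_k` and an orthonormal system of eigenfunctions `u_k`. -/
structure IsDiagonalForm {N : ℕ} (μ : Measure Λ) (K : Λ → Λ → CQuat) (lam : Fin N → ℂ)
    (u : Fin N → Λ → CQuat) : Prop where
  orthonormal : IsOrthonormalSystem μ u
  eq_sum : ∀ x y, K x y = ∑ k, ((lam k : ℂ) : CQuat) * (u k x * star (u k y))

/-- A quasi-real diagonal form: a diagonal form with real eigenvalues. -/
def IsQuasiRealForm {N : ℕ} (μ : Measure Λ) (K : Λ → Λ → CQuat) (lam : Fin N → ℝ)
    (u : Fin N → Λ → CQuat) : Prop :=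
  IsDiagonalForm μ K (fun k => (lam k : ℂ)) u

end Kernels

/-! ### Random point fields -/

section PointFields

variable {Λ : Type*} [TopologicalSpace Λ]

/-- A countable configuration of points of `Λ` (`mult x` is the number of points located
at `x`) with finitely many points in every compact set. -/
structure Configuration (Λ : Type*) [TopologicalSpace Λ] where
  mult : Λ → ℕ
  countable_support : (Function.support mult).Countable
  finite_compact : ∀ C : Set Λ, IsCompact C → (Function.support mult ∩ C).Finite

/-- The number `#(A)` of points of the configuration in `A`. -/
def Configuration.count (ξ : Configuration Λ) (A : Set Λ) : ℝ≥0∞ :=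
  ∑' x, A.indicator (fun y => (ξ.mult y : ℝ≥0∞)) x

/-- The σ-algebra on configurations generated by the numbers of points in measurable sets. -/
instance [MeasurableSpace Λ] : MeasurableSpace (Configuration Λ) :=
  ⨆ A : {A : Set Λ // MeasurableSet A},
    MeasurableSpace.comap (fun ξ : Configuration Λ => ξ.count A.1) inferInstance

/-- `n (n - 1) ⋯ (n - k + 1)` for a number of points `n ∈ {0, 1, …, ∞}` (truncated subtraction
gives `0` when `n < k`). -/
def fallingFactorial (n : ℝ≥0∞) (k : ℕ) : ℝ≥0∞ :=
  ∏ j ∈ Finset.range k, (n - (j : ℝ≥0∞))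

variable [MeasurableSpace Λ]

/-- The set `A_1^{k_1} × ⋯ × A_m^{k_m}` in `Λ^k`, where `k = k_1 + ⋯ + k_m`. -/
def blockBox {m k : ℕ} (A : Fin m → Set Λ) (n : Fin m → ℕ) (hk : ∑ i, n i = k) :
    Set (Fin k → Λ) :=
  {x | ∀ (i : Fin m) (j : Fin (n i)), x (Fin.cast hk (finSigmaFinEquiv ⟨i, j⟩)) ∈ A i}

/-- `R` is a `k`-point correlation function, with respect to `μ`, of the random point field
with law `P`. -/
structure IsCorrelationFunction (μ : Measure Λ) (P : Measure (Configuration Λ)) (k : ℕ)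
    (R : (Fin k → Λ) → ℝ) : Prop where
  nonneg : ∀ x, 0 ≤ R x
  locallyIntegrable : LocallyIntegrable R (Measure.pi fun _ : Fin k => μ)
  expectation : ∀ (m : ℕ) (A : Fin m → Set Λ) (n : Fin m → ℕ) (hk : ∑ i, n i = k),
    (∀ i, MeasurableSet (A i)) → Pairwise (fun i j => Disjoint (A i) (A j)) →
    ∫⁻ ξ, ∏ i, fallingFactorial (ξ.count (A i)) (n i) ∂P =
      ∫⁻ x in blockBox A n hk, ENNReal.ofReal (R x) ∂(Measure.pi fun _ : Fin k => μ)

/-- The random point field with law `P` is Pfaffian with kernel `K`: the kernel is self-dual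
and the determinants `Det_M (K (x i) (x j))` are its correlation functions. -/
structure IsPfaffianPointField (μ : Measure Λ) (P : Measure (Configuration Λ))
    (K : Λ → Λ → CQuat) : Prop where
  isProbability : IsProbabilityMeasure P
  selfDual : IsSelfDualKernel K
  correlation : ∀ k : ℕ, 1 ≤ k → ∃ R : (Fin k → Λ) → ℝ,
    IsCorrelationFunction μ P k R ∧
      ∀ x : Fin k → Λ, mooreDet (kernelMatrix K x) = ((R x : ℂ) : CQuat)

/-- The kernel `K` defines a Pfaffian point field. -/
def DefinesPfaffianPointField (μ : Measure Λ) (K : Λ → Λ → CQuat) : Prop :=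
  ∃ P : Measure (Configuration Λ), IsPfaffianPointField μ P K

end PointFields

end

/-! Everything rests on one algebraic fact, `isRankOneAffine`: for self-dual `Y`, the Moore–Dyson
determinant of `Y + t w w^*` is affine in `t`. Quaternions do not commute, so neither Laplace
expansion nor the multiplicativity of determinants is available. The substitute is the recursion
`mooreDet_succ`, which deletes the smallest index: it is either a fixed point or sits inside another
cycle, where it can be bypassed. For self-dual matrices the recursion reads `Det X = X₀₀ Det Y -
D_Y(v v^*)`, with `Y` the remaining block, `v` the rest of column 0 and `D_Y` the derivative at `Y`.
Induction on the size then gives rank-one affinity.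

Three consequences follow for self-dual matrices. The determinant is invariant under simultaneous
permutation of rows and columns (`mooreDet_submatrix_perm`). Interpolating in each eigenvalue makes
`Det (∑ λ_k w_k w_k^*)` the average of `Det (∑_{k ∈ I} w_k w_k^*)` when `I` is chosen by independent
Bernoulli(`λ_k`) trials (`mooreDet_add_sum_smul_quatOuter`). Finally, the recursion with
orthonormality gives Dyson's relation: integrating one point out of the `(m+1)`-point determinant of
`K_I` yields `(|I| - m)` times the `m`-point determinant
(`IsOrthonormalSystem.integral_kernelDet_cons`).

For each `I`, with `n = |I|`, the `n`-point determinant divided by `n!` is therefore a symmetric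
probability density on `Λ^n`. The resulting field of `n` points has the determinants of `K_I` as its
correlation functions (`IsDysonFamily.exists_pointField`). Correlation functions are linear in the
law, so mixing these fields with the Bernoulli weights produces the field of `K`. -/

/-! ### Removing the smallest index from the Moore–Dyson determinant -/

section Recursion

/-- The product of the entries along the first `k` steps of the orbit of `a`. -/
noncomputable def orbitProd {n : ℕ} (X : Matrix (Fin n) (Fin n) CQuat) (σ : Equiv.Perm (Fin n))
    (a : Fin n) (k : ℕ) : CQuat :=
  ((List.range k).map (fun i => X ((σ ^ i) a) ((σ ^ (i + 1)) a))).prod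

theorem orbitProd_succ {n : ℕ} (X : Matrix (Fin n) (Fin n) CQuat) (σ : Equiv.Perm (Fin n))
    (a : Fin n) (k : ℕ) :
    orbitProd X σ a (k + 1) = orbitProd X σ a k * X ((σ ^ k) a) ((σ ^ (k + 1)) a) := by
  simp [orbitProd, List.range_succ]

/-- `σ` is obtained from `e` by shifting all indices up and inserting `0` after the elements
satisfying `s` (there is at most one of them). -/
structure IsInsertion {n : ℕ} (σ : Equiv.Perm (Fin (n + 1))) (e : Equiv.Perm (Fin n))
    (s : Fin n → Prop) : Prop where
  not_mem : ∀ c, ¬ s c → σ c.succ = (e c).succ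
  mem : ∀ c, s c → σ c.succ = 0 ∧ σ 0 = (e c).succ

/-- The time at which the orbit of `c.succ` under the insertion reaches `(e ^ k) c`. -/
def insertTime {n : ℕ} (e : Equiv.Perm (Fin n)) (s : Fin n → Prop) [DecidablePred s]
    (c : Fin n) : ℕ → ℕ
  | 0 => 0
  | k + 1 => insertTime e s c k + if s ((e ^ k) c) then 2 else 1

namespace IsInsertion

variable {n : ℕ} {σ : Equiv.Perm (Fin (n + 1))} {e : Equiv.Perm (Fin n)} {s : Fin n → Prop}
  [DecidablePred s]

theorem pow_insertTime (h : IsInsertion σ e s) (c : Fin n) (k : ℕ) :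
    (σ ^ insertTime e s c k) c.succ = ((e ^ k) c).succ := by
  induction k with
  | zero => simp [insertTime]
  | succ k ih =>
    rw [insertTime]
    split_ifs with hs
    · rw [pow_succ', pow_succ', Equiv.Perm.mul_apply, Equiv.Perm.mul_apply, ih,
        (h.mem _ hs).1, (h.mem _ hs).2, pow_succ', Equiv.Perm.mul_apply]
    · rw [pow_succ', Equiv.Perm.mul_apply, ih, h.not_mem _ hs, pow_succ', Equiv.Perm.mul_apply]

theorem le_insertTime (c : Fin n) (k : ℕ) : k ≤ insertTime e s c k := by
  induction k with
  | zero => simp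
  | succ k ih => rw [insertTime]; split_ifs <;> omega

theorem insertTime_strictMono (c : Fin n) : StrictMono (insertTime e s c) :=
  strictMono_nat_of_lt_succ fun k => by rw [insertTime]; split_ifs <;> omega

/-- Consecutive insertion times differ by one or two, and the only time that can be skipped is a
visit to `0`. -/
theorem eq_insertTime_or (h : IsInsertion σ e s) (c : Fin n) (k j : ℕ)
    (hj : j ≤ insertTime e s c k) :
    (∃ i ≤ k, j = insertTime e s c i) ∨ (σ ^ j) c.succ = 0 := by
  induction k with
  | zero => exact Or.inl ⟨0, le_rfl, by simpa [insertTime] using hj⟩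
  | succ k ih =>
    by_cases hjk : j ≤ insertTime e s c k
    · rcases ih hjk with ⟨i, hi, rfl⟩ | h0
      · exact Or.inl ⟨i, by omega, rfl⟩
      · exact Or.inr h0
    · by_cases hj' : j = insertTime e s c (k + 1)
      · exact Or.inl ⟨k + 1, le_rfl, hj'⟩
      · right
        rw [insertTime] at hj hj'
        split_ifs at hj hj' with hs
        · have : j = insertTime e s c k + 1 := by omega
          rw [this, pow_succ', Equiv.Perm.mul_apply, h.pow_insertTime, (h.mem _ hs).1]
        · omega

theorem sameCycle_iff (h : IsInsertion σ e s) (c d : Fin n) :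
    σ.SameCycle c.succ d.succ ↔ e.SameCycle c d := by
  constructor
  · intro hc
    obtain ⟨j, -, hj⟩ := hc.exists_pow_eq'
    rcases h.eq_insertTime_or c j j (le_insertTime c j) with ⟨i, -, rfl⟩ | h0
    · rw [h.pow_insertTime] at hj
      exact ⟨i, by simpa using hj⟩
    · exact absurd (h0.symm.trans hj).symm (Fin.succ_ne_zero d)
  · intro hc
    obtain ⟨j, -, hj⟩ := hc.exists_pow_eq'
    exact ⟨insertTime e s c j, by rw [zpow_natCast, h.pow_insertTime, hj]⟩

theorem minimalPeriod_eq (h : IsInsertion σ e s) (c : Fin n) :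
    Function.minimalPeriod σ c.succ = insertTime e s c (Function.minimalPeriod e c) := by
  set l := Function.minimalPeriod e c with hl
  have hlpos : 0 < l := Function.minimalPeriod_pos_of_mem_periodicPts
    (Function.Injective.mem_periodicPts e.injective c)
  have hper : (e ^ l) c = c := by
    have := Function.iterate_minimalPeriod (f := e) (x := c)
    rwa [Equiv.Perm.iterate_eq_pow] at this
  have hσ : (σ ^ insertTime e s c l) c.succ = c.succ := by rw [h.pow_insertTime, hper]
  apply le_antisymm
  · apply Function.IsPeriodicPt.minimalPeriod_le (lt_of_lt_of_le hlpos (le_insertTime c l))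
    rw [Function.IsPeriodicPt, Function.IsFixedPt, Equiv.Perm.iterate_eq_pow, hσ]
  · set q := Function.minimalPeriod σ c.succ with hq
    have hqpos : 0 < q := Function.minimalPeriod_pos_of_mem_periodicPts
      (Function.Injective.mem_periodicPts σ.injective c.succ)
    have hqper : (σ ^ q) c.succ = c.succ := by
      have := Function.iterate_minimalPeriod (f := σ) (x := c.succ)
      rwa [Equiv.Perm.iterate_eq_pow] at this
    rcases h.eq_insertTime_or c q q (le_insertTime c q) with ⟨i, -, hi⟩ | h0
    · rw [hi] at hqper ⊢
      rw [h.pow_insertTime] at hqper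
      have hi0 : 0 < i := by
        rcases Nat.eq_zero_or_pos i with rfl | h
        · simp [insertTime] at hi; omega
        · exact h
      apply (insertTime_strictMono c).monotone
      apply Function.IsPeriodicPt.minimalPeriod_le hi0
      rw [Function.IsPeriodicPt, Function.IsFixedPt, Equiv.Perm.iterate_eq_pow]
      exact Fin.succ_injective _ hqper
    · exact absurd (h0.symm.trans hqper).symm (Fin.succ_ne_zero c)

/-- A detour `c → 0 → e c` contributes two factors of `X`; merging them into one entry of `Z` makes
the products agree without reordering, which noncommutativity requires. -/
theorem orbitProd_eq (h : IsInsertion σ e s) (X : Matrix (Fin (n + 1)) (Fin (n + 1)) CQuat)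
    (Z : Matrix (Fin n) (Fin n) CQuat)
    (hs : ∀ c, s c → Z c (e c) = X c.succ 0 * X 0 (e c).succ)
    (hns : ∀ c, ¬ s c → Z c (e c) = X c.succ (e c).succ) (c : Fin n) (k : ℕ) :
    orbitProd X σ c.succ (insertTime e s c k) = orbitProd Z e c k := by
  induction k with
  | zero => simp [insertTime, orbitProd]
  | succ k ih =>
    have hp := h.pow_insertTime c (k + 1)
    have h1 : (e ^ (k + 1)) c = e ((e ^ k) c) := by rw [pow_succ', Equiv.Perm.mul_apply]
    rw [orbitProd_succ, ← ih, h1]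
    rw [insertTime] at hp ⊢
    split_ifs at hp ⊢ with hsk
    · rw [orbitProd_succ, orbitProd_succ, hs _ hsk, hp, h1, h.pow_insertTime, mul_assoc]
      have : (σ ^ (insertTime e s c k + 1)) c.succ = 0 := by
        rw [pow_succ', Equiv.Perm.mul_apply, h.pow_insertTime, (h.mem _ hsk).1]
      rw [this]
    · rw [orbitProd_succ, hns _ hsk, hp, h1, h.pow_insertTime]

theorem cycleProd_eq (h : IsInsertion σ e s) (X : Matrix (Fin (n + 1)) (Fin (n + 1)) CQuat)
    (Z : Matrix (Fin n) (Fin n) CQuat)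
    (hs : ∀ c, s c → Z c (e c) = X c.succ 0 * X 0 (e c).succ)
    (hns : ∀ c, ¬ s c → Z c (e c) = X c.succ (e c).succ) (c : Fin n) :
    cycleProd X σ c.succ = cycleProd Z e c := by
  have := h.orbitProd_eq X Z hs hns c (Function.minimalPeriod e c)
  rw [← h.minimalPeriod_eq] at this
  exact this

theorem leader_iff (h : IsInsertion σ e s) (c : Fin n) :
    (∀ b, σ.SameCycle c.succ b → b ≤ c.succ) ↔ ∀ b, e.SameCycle c b → b ≤ c := by
  constructor
  · intro H b hb
    have := H b.succ ((h.sameCycle_iff c b).2 hb)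
    simpa using this
  · intro H b hb
    induction b using Fin.cases with
    | zero => exact Fin.zero_le _
    | succ b => simpa using H b ((h.sameCycle_iff c b).1 hb)

/-- Being the smallest index, `0` leads a cycle only if it is fixed, and its cycle is then last in
the decreasing order. This is why `X 0 0` appears as a right factor in the recursion. -/
theorem cycleLeaders_eq (h : IsInsertion σ e s) :
    cycleLeaders σ = (cycleLeaders e).map Fin.succ ++ if σ 0 = 0 then [0] else [] := by
  classical
  unfold cycleLeaders
  rw [List.finRange_succ, List.reverse_cons, List.filter_append, ← List.map_reverse,
    List.filter_map]
  congr 1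
  · congr 1
    apply List.filter_congr
    intro c _
    simp only [Function.comp, decide_eq_decide]
    exact h.leader_iff c
  · split_ifs with h0
    · rw [List.filter_cons_of_pos]
      · rfl
      · simp only [decide_eq_true_eq]
        rintro b ⟨i, hi⟩
        rw [Equiv.Perm.zpow_apply_eq_self_of_apply_eq_self h0] at hi
        exact hi.symm.le
    · rw [List.filter_cons_of_neg]
      · rfl
      · simp only [decide_eq_true_eq]
        intro H
        exact h0 (le_antisymm (H (σ 0) ⟨1, by simp⟩) (Fin.zero_le _))

theorem cycleProds_eq (h : IsInsertion σ e s) (X : Matrix (Fin (n + 1)) (Fin (n + 1)) CQuat)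
    (Z : Matrix (Fin n) (Fin n) CQuat)
    (hs : ∀ c, s c → Z c (e c) = X c.succ 0 * X 0 (e c).succ)
    (hns : ∀ c, ¬ s c → Z c (e c) = X c.succ (e c).succ) :
    ((cycleLeaders σ).map (cycleProd X σ)).prod =
      ((cycleLeaders e).map (cycleProd Z e)).prod * if σ 0 = 0 then X 0 0 else 1 := by
  rw [h.cycleLeaders_eq, List.map_append, List.prod_append, List.map_map]
  congr 1
  · congr 2
    funext c
    exact h.cycleProd_eq X Z hs hns c
  · split_ifs with h0
    · have : Function.minimalPeriod σ 0 = 1 := by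
        rw [Function.minimalPeriod_eq_one_iff_isFixedPt]; exact h0
      simp [cycleProd, this, h0]
    · simp

end IsInsertion

theorem isInsertion_decomposeFin_zero {n : ℕ} (e : Equiv.Perm (Fin n)) :
    IsInsertion (Equiv.Perm.decomposeFin.symm (0, e)) e (fun _ => False) where
  not_mem c _ := by simp
  mem c h := h.elim

theorem isInsertion_decomposeFin_succ {n : ℕ} (e : Equiv.Perm (Fin n)) (a : Fin n) :
    IsInsertion (Equiv.Perm.decomposeFin.symm ((e a).succ, e)) e (fun c => c = a) where
  not_mem c hc := by
    rw [Equiv.Perm.decomposeFin_symm_apply_succ, Equiv.swap_apply_of_ne_of_ne]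
    · exact Fin.succ_ne_zero _
    · simpa using hc
  mem c hc := by subst hc; simp

/-- A permutation either fixes `0` or arises from a permutation of the other indices by inserting
`0` after a unique `a`, which flips the sign. Row `a` of the updated matrix carries the two-step
products through `0`. -/
theorem mooreDet_succ {n : ℕ} (X : Matrix (Fin (n + 1)) (Fin (n + 1)) CQuat) :
    mooreDet X = mooreDet (X.submatrix Fin.succ Fin.succ) * X 0 0 -
      ∑ a, mooreDet ((X.submatrix Fin.succ Fin.succ).updateRow a
        (fun b => X a.succ 0 * X 0 b.succ)) := by
  unfold mooreDet
  rw [← Equiv.Perm.decomposeFin.symm.sum_comp, Fintype.sum_prod_type, Fin.sum_univ_succ,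
    sub_eq_add_neg, Finset.sum_mul]
  congr 1
  · refine Finset.sum_congr rfl fun e _ => ?_
    rw [(isInsertion_decomposeFin_zero e).cycleProds_eq X (X.submatrix Fin.succ Fin.succ)
      (fun c h => h.elim) (fun c _ => rfl)]
    simp [mul_assoc]
  · rw [Finset.sum_comm, Finset.sum_comm (s := (Finset.univ : Finset (Fin n))),
      ← Finset.sum_neg_distrib]
    refine Finset.sum_congr rfl fun e _ => ?_
    rw [← Finset.sum_neg_distrib]
    -- `decomposeFin` records the image of `0`; reindexing by `e` records instead the element `a`
    -- that precedes `0`.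
    refine (Equiv.sum_comp e _).symm.trans ?_
    refine Finset.sum_congr rfl fun a _ => ?_
    rw [(isInsertion_decomposeFin_succ e a).cycleProds_eq X
      ((X.submatrix Fin.succ Fin.succ).updateRow a (fun b => X a.succ 0 * X 0 b.succ))
      (fun c h => by subst h; simp) (fun c h => by simp [Matrix.updateRow_ne h])]
    simp

theorem mooreDet_fin_zero (X : Matrix (Fin 0) (Fin 0) CQuat) : mooreDet X = 1 := by
  simp [mooreDet, cycleLeaders]

end Recursion

/-- The scalar action coming from the algebra structure of the complexified quaternions. -/
instance CQuat.instSMulComplex : SMul ℂ CQuat := Algebra.toSMul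

theorem CQuat.coe_mul (c : ℂ) (a : CQuat) : (c : CQuat) * a = c • a :=
  Quaternion.coe_mul_eq_smul c a

theorem CQuat.mul_coe (c : ℂ) (a : CQuat) : a * (c : CQuat) = c • a :=
  Quaternion.mul_coe_eq_smul c a

theorem CQuat.star_add (a b : CQuat) : star (a + b) = star a + star b :=
  StarAddMonoid.star_add a b

theorem CQuat.star_smul (c : ℂ) (a : CQuat) : star (c • a) = c • star a :=
  Quaternion.star_smul c a

/-! ### Complex multilinearity in the rows, and the derivative of the determinant -/

section Multilinear

theorem mooreDet_updateRow_zero {n : ℕ} (X : Matrix (Fin (n + 1)) (Fin (n + 1)) CQuat)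
    (p : Fin (n + 1) → CQuat) :
    mooreDet (X.updateRow 0 p) = mooreDet (X.submatrix Fin.succ Fin.succ) * p 0 -
      ∑ a, mooreDet ((X.submatrix Fin.succ Fin.succ).updateRow a
        (fun b => X a.succ 0 * p b.succ)) := by
  have : (X.updateRow 0 p).submatrix Fin.succ Fin.succ = X.submatrix Fin.succ Fin.succ := by
    ext1 a b; simp [Matrix.updateRow_ne]
  rw [mooreDet_succ, this]
  simp [Matrix.updateRow_ne]

theorem mooreDet_updateRow_succ {n : ℕ} (X : Matrix (Fin (n + 1)) (Fin (n + 1)) CQuat)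
    (i : Fin n) (p : Fin (n + 1) → CQuat) :
    mooreDet (X.updateRow i.succ p) =
      mooreDet ((X.submatrix Fin.succ Fin.succ).updateRow i (fun b => p b.succ)) * X 0 0 -
      (mooreDet ((X.submatrix Fin.succ Fin.succ).updateRow i (fun b => p 0 * X 0 b.succ)) +
      ∑ a ∈ Finset.univ.erase i, mooreDet (((X.submatrix Fin.succ Fin.succ).updateRow a
        (fun b => X a.succ 0 * X 0 b.succ)).updateRow i (fun b => p b.succ))) := by
  have : (X.updateRow i.succ p).submatrix Fin.succ Fin.succ =
      (X.submatrix Fin.succ Fin.succ).updateRow i (fun b => p b.succ) := by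
    ext1 a b
    by_cases h : a = i
    · subst h; simp
    · have : a.succ ≠ i.succ := fun h' => h (Fin.succ_injective _ h')
      simp [Matrix.updateRow_ne h, Matrix.updateRow_ne this]
  have h0 : (0 : Fin (n + 1)) ≠ i.succ := (Fin.succ_ne_zero i).symm
  rw [mooreDet_succ, this, ← Finset.add_sum_erase _ _ (Finset.mem_univ i)]
  simp only [Matrix.updateRow_ne h0, Matrix.updateRow_idem, Matrix.updateRow_self]
  congr 2
  refine Finset.sum_congr rfl fun a ha => ?_
  have hne : a ≠ i := Finset.ne_of_mem_erase ha
  have hne' : a.succ ≠ i.succ := fun h' => hne (Fin.succ_injective _ h')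
  rw [Matrix.updateRow_ne hne', Matrix.updateRow_comm _ hne.symm]

/-- Each term has exactly one factor from row `i`. In the recursion that row enters through a row of
the minor, possibly multiplied by a fixed quaternion, or through a single outer factor, so
additivity passes to the smaller size. -/
theorem mooreDet_updateRow_add {n : ℕ} (X : Matrix (Fin n) (Fin n) CQuat) (i : Fin n)
    (p q : Fin n → CQuat) :
    mooreDet (X.updateRow i (p + q)) = mooreDet (X.updateRow i p) + mooreDet (X.updateRow i q) := by
  induction n with
  | zero => exact i.elim0
  | succ n ih =>
    induction i using Fin.cases with
    | zero =>
      have h : ∀ a, mooreDet ((X.submatrix Fin.succ Fin.succ).updateRow a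
            (fun b => X a.succ 0 * (p + q) b.succ)) =
          mooreDet ((X.submatrix Fin.succ Fin.succ).updateRow a
            (fun b => X a.succ 0 * p b.succ)) +
          mooreDet ((X.submatrix Fin.succ Fin.succ).updateRow a
            (fun b => X a.succ 0 * q b.succ)) := fun a => by
        rw [← ih]; congr 2; funext b; simp [mul_add]
      simp only [mooreDet_updateRow_zero, h, Finset.sum_add_distrib]
      rw [Pi.add_apply, mul_add, add_sub_add_comm]
    | succ i =>
      have h1 : ∀ Y : Matrix (Fin n) (Fin n) CQuat,
          mooreDet (Y.updateRow i (fun b => (p + q) b.succ)) =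
          mooreDet (Y.updateRow i (fun b => p b.succ)) +
          mooreDet (Y.updateRow i (fun b => q b.succ)) := fun Y => ih Y i _ _
      have h2 : ∀ Y : Matrix (Fin n) (Fin n) CQuat,
          mooreDet (Y.updateRow i (fun b => (p + q) 0 * X 0 b.succ)) =
          mooreDet (Y.updateRow i (fun b => p 0 * X 0 b.succ)) +
          mooreDet (Y.updateRow i (fun b => q 0 * X 0 b.succ)) := fun Y => by
        rw [← ih Y i]; congr 2; funext b; simp [add_mul]
      simp only [mooreDet_updateRow_succ, h1, h2, Finset.sum_add_distrib, add_mul]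
      abel

theorem mooreDet_updateRow_smul {n : ℕ} (X : Matrix (Fin n) (Fin n) CQuat) (i : Fin n)
    (c : ℂ) (p : Fin n → CQuat) :
    mooreDet (X.updateRow i (c • p)) = c • mooreDet (X.updateRow i p) := by
  induction n with
  | zero => exact i.elim0
  | succ n ih =>
    induction i using Fin.cases with
    | zero =>
      have h : ∀ a, mooreDet ((X.submatrix Fin.succ Fin.succ).updateRow a
            (fun b => X a.succ 0 * (c • p) b.succ)) =
          c • mooreDet ((X.submatrix Fin.succ Fin.succ).updateRow a
            (fun b => X a.succ 0 * p b.succ)) := fun a => by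
        rw [← ih]; congr 2; funext b; simp
      simp only [mooreDet_updateRow_zero, h, smul_sub, Finset.smul_sum]
      rw [Pi.smul_apply, mul_smul_comm]
    | succ i =>
      have h1 : ∀ Y : Matrix (Fin n) (Fin n) CQuat,
          mooreDet (Y.updateRow i (fun b => (c • p) b.succ)) =
          c • mooreDet (Y.updateRow i (fun b => p b.succ)) := fun Y => ih Y i _
      have h2 : ∀ Y : Matrix (Fin n) (Fin n) CQuat,
          mooreDet (Y.updateRow i (fun b => (c • p) 0 * X 0 b.succ)) =
          c • mooreDet (Y.updateRow i (fun b => p 0 * X 0 b.succ)) := fun Y => by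
        rw [← ih Y i]; congr 2; funext b; simp
      simp only [mooreDet_updateRow_succ, h1, h2, Finset.smul_sum, smul_sub, smul_add,
        smul_mul_assoc]

/-- The Moore–Dyson determinant as a multilinear function of the rows. -/
noncomputable def mooreDetRowMultilinear (n : ℕ) :
    MultilinearMap ℂ (fun _ : Fin n => Fin n → CQuat) CQuat where
  toFun X := mooreDet (Matrix.of X)
  map_update_add' {inst} X i p q := by
    rw [Subsingleton.elim inst (instDecidableEqFin n)]
    exact mooreDet_updateRow_add (Matrix.of X) i p q
  map_update_smul' {inst} X i c p := by
    rw [Subsingleton.elim inst (instDecidableEqFin n)]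
    exact mooreDet_updateRow_smul (Matrix.of X) i c p

/-- The derivative of the Moore–Dyson determinant at `Y` in the direction `H`. -/
noncomputable def mooreDeriv {n : ℕ} (Y : Matrix (Fin n) (Fin n) CQuat) :
    Matrix (Fin n) (Fin n) CQuat →ₗ[ℂ] CQuat where
  toFun H := ∑ a, mooreDet (Y.updateRow a (H a))
  map_add' H G := by
    rw [← Finset.sum_add_distrib]
    exact Finset.sum_congr rfl fun a _ => mooreDet_updateRow_add _ _ _ _
  map_smul' c H := by
    rw [RingHom.id_apply, Finset.smul_sum]
    exact Finset.sum_congr rfl fun a _ => mooreDet_updateRow_smul _ _ _ _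

theorem mooreDeriv_apply {n : ℕ} (Y H : Matrix (Fin n) (Fin n) CQuat) :
    mooreDeriv Y H = ∑ a, mooreDet (Y.updateRow a (H a)) := rfl

/-- Euler's identity for a function homogeneous of degree `n`. -/
theorem mooreDeriv_self {n : ℕ} (Y : Matrix (Fin n) (Fin n) CQuat) :
    mooreDeriv Y Y = (n : ℂ) • mooreDet Y := by
  simp [mooreDeriv_apply, Algebra.smul_def]

/-- After applying a linear functional this is a comparison of coefficients of `t` in two
polynomials. -/
theorem eq_zero_of_forall_smul_eq_sum {V ι : Type*} [AddCommGroup V] [Module ℂ V] (w : V)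
    (S : Finset ι) (e : ι → ℕ) (v : ι → V) (he : ∀ i ∈ S, 2 ≤ e i)
    (h : ∀ t : ℂ, t • w = ∑ i ∈ S, t ^ e i • v i) : w = 0 := by
  rw [← Module.forall_dual_apply_eq_zero_iff ℂ w]
  intro φ
  have hp : (Polynomial.C (φ w) * Polynomial.X : Polynomial ℂ) =
      ∑ i ∈ S, Polynomial.C (φ (v i)) * Polynomial.X ^ e i := by
    apply Polynomial.funext
    intro t
    have := congrArg φ (h t)
    simp only [map_smul, map_sum, smul_eq_mul] at this
    simp only [Polynomial.eval_finsetSum, Polynomial.eval_mul, Polynomial.eval_C,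
      Polynomial.eval_X, Polynomial.eval_pow]
    rw [mul_comm, this]
    exact Finset.sum_congr rfl fun i _ => mul_comm _ _
  have h1 := congrArg (fun p => p.coeff 1) hp
  simp only [Polynomial.finsetSum_coeff, Polynomial.coeff_C_mul, Polynomial.coeff_X_pow,
    Polynomial.coeff_X_one, mul_one] at h1
  rw [h1]
  refine Finset.sum_eq_zero fun i hi => ?_
  have := he i hi
  rw [if_neg (by omega), mul_zero]

/-- In the multilinear expansion of `Det (Y + t H)`, terms taking at least two rows from `H` carry
`t^2` or higher, so an affine restriction must have the derivative as its slope. -/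
theorem mooreDeriv_eq_of_affine {n : ℕ} (Y H : Matrix (Fin n) (Fin n) CQuat) (c : CQuat)
    (h : ∀ t : ℂ, mooreDet (Y + t • H) = mooreDet Y + t • c) : mooreDeriv Y H = c := by
  rw [← sub_eq_zero, ← neg_eq_zero, neg_sub]
  refine eq_zero_of_forall_smul_eq_sum _ (Finset.univ.filter fun s : Finset (Fin n) => 2 ≤ s.card)
    Finset.card (fun s => mooreDetRowMultilinear n (s.piecewise H Y)) (by simp) fun t => ?_
  have h3 : (mooreDetRowMultilinear n).linearDeriv Y (t • H) = mooreDeriv Y (t • H) :=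
    MultilinearMap.linearDeriv_apply _ _ _
  rw [map_smul] at h3
  have h1 : mooreDet Y + t • c = mooreDet Y + t • mooreDeriv Y H +
      ∑ s : Finset (Fin n) with 2 ≤ s.card,
        mooreDetRowMultilinear n (s.piecewise (t • H) Y) := by
    rw [← h t, ← h3]
    exact (mooreDetRowMultilinear n).map_add_eq_map_add_linearDeriv_add Y (t • H)
  rw [add_assoc, add_right_inj, ← sub_eq_iff_eq_add'] at h1
  refine (smul_sub t c _).trans (h1.trans ?_)
  refine Finset.sum_congr rfl fun s _ => ?_
  have := (mooreDetRowMultilinear n).map_piecewise_smul (fun _ => t) (s.piecewise H Y) s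
  simp only [Finset.prod_const] at this
  rw [← this]
  congr 1
  funext a
  by_cases ha : a ∈ s
  · exact (Finset.piecewise_eq_of_mem s _ _ ha).trans (.symm <|
      (Finset.piecewise_eq_of_mem s _ _ ha).trans
        (congrArg (t • ·) (Finset.piecewise_eq_of_mem s H Y ha)))
  · exact (Finset.piecewise_eq_of_notMem s _ _ ha).trans (.symm <|
      (Finset.piecewise_eq_of_notMem s _ _ ha).trans
        (Finset.piecewise_eq_of_notMem s H Y ha))

end Multilinear

/-! ### Affinity along self-dual rank-one directions -/

section RankOne

/-- The matrix `(w_a z_b^*)`. -/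
def quatOuter {n : ℕ} (w z : Fin n → CQuat) : Matrix (Fin n) (Fin n) CQuat :=
  Matrix.of fun a b => w a * star (z b)

theorem quatOuter_apply {n : ℕ} (w z : Fin n → CQuat) (a b : Fin n) :
    quatOuter w z a b = w a * star (z b) := rfl

theorem quatOuter_add_smul {n : ℕ} (w z : Fin n → CQuat) (τ : ℂ) :
    quatOuter (w + τ • z) (w + τ • z) =
      quatOuter w w + τ • (quatOuter w z + quatOuter z w) + τ ^ 2 • quatOuter z z := by
  ext1 a b
  simp only [quatOuter_apply, Pi.add_apply, Pi.smul_apply, Matrix.add_apply, Matrix.smul_apply,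
    CQuat.star_add, CQuat.star_smul, mul_add, add_mul, smul_mul_assoc, mul_smul_comm]
  module

theorem quatOuter_add {n : ℕ} (w z : Fin n → CQuat) :
    quatOuter (w + z) (w + z) =
      quatOuter w w + (quatOuter w z + quatOuter z w) + quatOuter z z := by
  simpa using quatOuter_add_smul w z 1

theorem quatOuter_mul_right {n : ℕ} (w : Fin n → CQuat) (q : CQuat) :
    quatOuter (fun a => w a * q) (fun a => w a * q) = Quaternion.normSq q • quatOuter w w := by
  ext1 a b
  simp only [quatOuter_apply, Matrix.smul_apply, star_mul]
  rw [mul_assoc, ← mul_assoc q, Quaternion.self_mul_star, CQuat.coe_mul,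
    mul_smul_comm]

theorem quatOuter_mul_left_eq {n : ℕ} (w z : Fin n → CQuat) (q : CQuat) :
    quatOuter (fun a => w a * q) z = quatOuter w (fun a => z a * star q) := by
  ext1 a b
  simp [quatOuter_apply, mul_assoc]

theorem isSelfDual_quatOuter {n : ℕ} (w : Fin n → CQuat) : IsSelfDualKernel (quatOuter w w) :=
  fun a b => by simp [quatOuter_apply]

theorem IsSelfDualKernel.add {n : ℕ} {X Y : Matrix (Fin n) (Fin n) CQuat}
    (hX : IsSelfDualKernel X) (hY : IsSelfDualKernel Y) : IsSelfDualKernel (X + Y) :=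
  fun a b => by rw [Matrix.add_apply, Matrix.add_apply, CQuat.star_add, hX a b, hY a b]

theorem IsSelfDualKernel.smul {n : ℕ} {X : Matrix (Fin n) (Fin n) CQuat}
    (hX : IsSelfDualKernel X) (c : ℂ) : IsSelfDualKernel (c • X) :=
  fun a b => by rw [Matrix.smul_apply, Matrix.smul_apply, CQuat.star_smul, hX a b]

theorem IsSelfDualKernel.add_smul_quatOuter {n : ℕ} {X : Matrix (Fin n) (Fin n) CQuat}
    (hX : IsSelfDualKernel X) (c : ℂ) (w : Fin n → CQuat) :
    IsSelfDualKernel (X + c • quatOuter w w) :=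
  hX.add ((isSelfDual_quatOuter w).smul c)

theorem IsSelfDualKernel.add_quatOuter {n : ℕ} {X : Matrix (Fin n) (Fin n) CQuat}
    (hX : IsSelfDualKernel X) (w : Fin n → CQuat) :
    IsSelfDualKernel (X + quatOuter w w) :=
  hX.add (isSelfDual_quatOuter w)

theorem IsSelfDualKernel.submatrix {m n : ℕ} {X : Matrix (Fin n) (Fin n) CQuat}
    (hX : IsSelfDualKernel X) (f : Fin m → Fin n) : IsSelfDualKernel (X.submatrix f f) :=
  fun a b => hX (f a) (f b)

/-- Self-duality makes `X 0 0` a complex scalar and turns the two-step products `X a 0 * X 0 b` into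
the rank-one matrix `v v^*`; the sum over inserted rows is then a derivative. -/
theorem mooreDet_succ_of_isSelfDual {n : ℕ} {X : Matrix (Fin (n + 1)) (Fin (n + 1)) CQuat}
    (hX : IsSelfDualKernel X) :
    mooreDet X = (X 0 0).re • mooreDet (X.submatrix Fin.succ Fin.succ) -
      mooreDeriv (X.submatrix Fin.succ Fin.succ)
        (quatOuter (fun a => X a.succ 0) (fun a => X a.succ 0)) := by
  rw [mooreDet_succ, mooreDeriv_apply]
  congr 1
  · have h0 : X 0 0 = ((X 0 0).re : CQuat) := Quaternion.star_eq_self.1 (hX 0 0).symm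
    conv_lhs => rw [h0]
    exact CQuat.mul_coe _ _
  · refine Finset.sum_congr rfl fun a _ => ?_
    congr 2
    funext b
    rw [quatOuter_apply, hX 0 b.succ, star_star]

/-- The Moore–Dyson determinant is affine along self-dual matrices of rank one. -/
def IsRankOneAffine (n : ℕ) : Prop :=
  ∀ Y : Matrix (Fin n) (Fin n) CQuat, IsSelfDualKernel Y → ∀ (w : Fin n → CQuat) (t : ℂ),
    mooreDet (Y + t • quatOuter w w) = mooreDet Y + t • mooreDeriv Y (quatOuter w w)

/-- The second difference of the Moore–Dyson determinant in two directions of rank one. -/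
noncomputable def mooreMixed {n : ℕ} (Y : Matrix (Fin n) (Fin n) CQuat) (w z : Fin n → CQuat) :
    CQuat :=
  mooreDeriv (Y + quatOuter w w) (quatOuter z z) - mooreDeriv Y (quatOuter z z)

namespace IsRankOneAffine

variable {n : ℕ} {Y : Matrix (Fin n) (Fin n) CQuat}

theorem add_quatOuter (h : IsRankOneAffine n) (hY : IsSelfDualKernel Y) (w : Fin n → CQuat) :
    mooreDet (Y + quatOuter w w) = mooreDet Y + mooreDeriv Y (quatOuter w w) := by
  simpa using h Y hY w 1

/-- Evaluate the determinant at `Y + w w^* + z z^*`, adding the two rank-one terms in either order.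
-/
theorem mooreMixed_comm (h : IsRankOneAffine n) (hY : IsSelfDualKernel Y) (w z : Fin n → CQuat) :
    mooreMixed Y w z = mooreMixed Y z w := by
  have h1 := h.add_quatOuter hY w
  have h2 := h.add_quatOuter hY z
  have h3 := h.add_quatOuter (hY.add_quatOuter w) z
  have h4 := h.add_quatOuter (hY.add_quatOuter z) w
  rw [add_right_comm, h3, h1, h2] at h4
  unfold mooreMixed
  linear_combination (norm := module) h4

/-- Reach `Y + 2 w w^*` in one step with `t = 2`, and in two steps with `t = 1`. -/
theorem mooreMixed_self (h : IsRankOneAffine n) (hY : IsSelfDualKernel Y) (w : Fin n → CQuat) :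
    mooreMixed Y w w = 0 := by
  have h1 := h.add_quatOuter hY w
  have h3 := h.add_quatOuter (hY.add_quatOuter w) w
  have h2 := h Y hY w 2
  have h0 : (2 : ℂ) • quatOuter w w = quatOuter w w + quatOuter w w := by
    ext1 a b; exact two_smul ℂ (quatOuter w w a b)
  rw [h0, ← add_assoc, h3, h1] at h2
  unfold mooreMixed
  linear_combination (norm := module) h2

theorem mooreDeriv_add_smul (h : IsRankOneAffine n) (hY : IsSelfDualKernel Y)
    (w z : Fin n → CQuat) (t : ℂ) :
    mooreDeriv (Y + t • quatOuter w w) (quatOuter z z) =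
      mooreDeriv Y (quatOuter z z) + t • mooreMixed Y w z := by
  rw [h.mooreMixed_comm hY]
  have h1 := h Y hY w t
  have h2 := h.add_quatOuter hY z
  have h3 := h.add_quatOuter (hY.add_smul_quatOuter t w) z
  have h4 := h _ (hY.add_quatOuter z) w t
  rw [add_right_comm, h3, h1, h2] at h4
  unfold mooreMixed
  linear_combination (norm := module) h4

theorem mooreMixed_add_smul_right (Y : Matrix (Fin n) (Fin n) CQuat) (y w z : Fin n → CQuat)
    (τ : ℂ) :
    mooreMixed Y y (w + τ • z) = mooreMixed Y y w +
      τ • (mooreMixed Y y (w + z) - mooreMixed Y y w - mooreMixed Y y z) +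
      τ ^ 2 • mooreMixed Y y z := by
  unfold mooreMixed
  rw [quatOuter_add_smul, quatOuter_add]
  simp only [map_add, map_smul]
  module

/-- The mixed difference is symmetric, quadratic in each argument and zero on the diagonal. Its
value at the pair `(w + τ z, w + τ z)` is thus a polynomial in `τ` that vanishes identically, and
the coefficient of `τ` is twice the quantity in question. -/
theorem mooreMixed_polar_self (h : IsRankOneAffine n) (hY : IsSelfDualKernel Y)
    (w z : Fin n → CQuat) :
    mooreMixed Y w (w + z) - mooreMixed Y w z = 0 := by
  have key : ∀ τ : ℂ, (2 * τ) • (mooreMixed Y w (w + z) - mooreMixed Y w z) +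
      τ ^ 2 • ((4 : ℂ) • mooreMixed Y w z - (2 : ℂ) • mooreMixed Y w (w + z)
        - (2 : ℂ) • mooreMixed Y z (w + z)) +
      τ ^ 3 • (2 : ℂ) • (mooreMixed Y z (w + z) - mooreMixed Y w z) = 0 := by
    intro τ
    have h1 := h.mooreMixed_self hY (w + τ • z)
    rw [mooreMixed_add_smul_right, h.mooreMixed_comm hY (w + τ • z) w,
      h.mooreMixed_comm hY (w + τ • z) z, h.mooreMixed_comm hY (w + τ • z) (w + z),
      mooreMixed_add_smul_right, mooreMixed_add_smul_right, mooreMixed_add_smul_right,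
      h.mooreMixed_self hY, h.mooreMixed_self hY, h.mooreMixed_self hY,
      h.mooreMixed_comm hY (w + z) w, h.mooreMixed_comm hY (w + z) z,
      h.mooreMixed_comm hY z w] at h1
    linear_combination (norm := module) h1
  have k1 := key 1
  have k2 := key (-1)
  have k3 := key 2
  have k4 := key (-2)
  -- The weights at `τ = ±1, ±2` cancel the quadratic and cubic coefficients and halve the linear
  -- one.
  linear_combination (norm := module) (1 / 3 : ℂ) • k1 - (1 / 3 : ℂ) • k2 - (1 / 24 : ℂ) • k3
    + (1 / 24 : ℂ) • k4

/-- The polarized derivative at `w`, in a direction of the form `w z^* + z w^*`, does not change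
when `w w^*` is added. -/
theorem mooreDeriv_polar_add_smul (h : IsRankOneAffine n) (hY : IsSelfDualKernel Y)
    (w z : Fin n → CQuat) (t : ℂ) :
    mooreDeriv (Y + t • quatOuter w w) (quatOuter w z + quatOuter z w) =
      mooreDeriv Y (quatOuter w z + quatOuter z w) := by
  have h1 := h.mooreMixed_polar_self hY w z
  have h0 := h.mooreMixed_self hY w
  have e1 := h.mooreDeriv_add_smul hY w (w + z) t
  have e2 := h.mooreDeriv_add_smul hY w w t
  have e3 := h.mooreDeriv_add_smul hY w z t
  rw [quatOuter_add] at e1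
  simp only [map_add] at e1 ⊢
  linear_combination (norm := module) e1 - e2 - e3 + t • h1 - t • h0

/-- Expand both determinants at index `0`. The two `t^2` terms equal `N • D_Y(w' w'^*)` and cancel;
possible further powers of `t` vanish by `mooreMixed_self` and, for the cross term, by
`mooreDeriv_polar_add_smul`. The witness collects the coefficient of `t`. -/
theorem succ (h : IsRankOneAffine n) : IsRankOneAffine (n + 1) := by
  intro X hX w t
  obtain ⟨c, hc⟩ : ∃ c, ∀ t : ℂ, mooreDet (X + t • quatOuter w w) = mooreDet X + t • c := by
    set Y := X.submatrix Fin.succ Fin.succ with hY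
    have hYs : IsSelfDualKernel Y := hX.submatrix _
    set v : Fin n → CQuat := fun a => X a.succ 0 with hv
    set w' : Fin n → CQuat := fun a => w a.succ with hw'
    set q : CQuat := star (w 0) with hq
    set N : ℂ := Quaternion.normSq q with hN
    refine ⟨(X 0 0).re • mooreDeriv Y (quatOuter w' w') + N • mooreDet Y - mooreMixed Y w' v -
      mooreDeriv Y (quatOuter w' (fun a => v a * star q) + quatOuter (fun a => v a * star q) w'),
      fun t => ?_⟩
    rw [mooreDet_succ_of_isSelfDual (hX.add_smul_quatOuter t w), mooreDet_succ_of_isSelfDual hX]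
    have e1 : (X + t • quatOuter w w).submatrix Fin.succ Fin.succ =
        Y + t • quatOuter w' w' := rfl
    have e2 : (fun a : Fin n => (X + t • quatOuter w w) a.succ 0) =
        v + t • fun a => w' a * q := rfl
    have e3 : ((X + t • quatOuter w w) 0 0).re = (X 0 0).re + t * N := by
      rw [hN, hq, Quaternion.normSq_star, Quaternion.normSq_def]
      rfl
    rw [e1, e2, e3, quatOuter_add_smul, quatOuter_mul_right, map_add, map_add, map_smul, map_smul,
      map_smul, h Y hYs w' t, h.mooreDeriv_add_smul hYs w' v t,
      h.mooreDeriv_add_smul hYs w' w' t, h.mooreMixed_self hYs]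
    have e4 : quatOuter v (fun a => w' a * q) + quatOuter (fun a => w' a * q) v =
        quatOuter w' (fun a => v a * star q) + quatOuter (fun a => v a * star q) w' := by
      rw [quatOuter_mul_left_eq w' v q, quatOuter_mul_left_eq v w' (star q), star_star, add_comm]
    rw [e4, h.mooreDeriv_polar_add_smul hYs]
    module
  rw [hc t, mooreDeriv_eq_of_affine X _ c hc]

end IsRankOneAffine

theorem isRankOneAffine (n : ℕ) : IsRankOneAffine n := by
  induction n with
  | zero =>
    intro Y _ w t
    simp [mooreDet_fin_zero, mooreDeriv_apply]
  | succ n ih => exact ih.succ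

end RankOne

/-! ### Permutation invariance and expansion in the eigenvalues -/

section Symmetry

/-- Expanding at indices `0` and `1` gives an expression whose symmetry in these two indices can be
checked term by term. -/
theorem mooreDet_succ_succ_of_isSelfDual {n : ℕ}
    {X : Matrix (Fin (n + 2)) (Fin (n + 2)) CQuat} (hX : IsSelfDualKernel X)
    (Y : Matrix (Fin n) (Fin n) CQuat) (v v' : Fin n → CQuat)
    (hY : Y = X.submatrix (fun a => a.succ.succ) (fun a => a.succ.succ))
    (hv : v = fun a => X a.succ.succ 0) (hv' : v' = fun a => X a.succ.succ 1) :
    mooreDet X = ((X 0 0).re * (X 1 1).re - Quaternion.normSq (X 1 0)) • mooreDet Y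
      - (X 0 0).re • mooreDeriv Y (quatOuter v' v') - (X 1 1).re • mooreDeriv Y (quatOuter v v)
      + mooreMixed Y v v' + mooreDeriv Y (quatOuter v (fun a => v' a * X 1 0)
        + quatOuter (fun a => v' a * X 1 0) v) := by
  have hYs : IsSelfDualKernel Y := hY ▸ hX.submatrix _
  have hA := isRankOneAffine n
  set Z := X.submatrix Fin.succ Fin.succ with hZ
  have hZs : IsSelfDualKernel Z := hX.submatrix _
  set z : Fin (n + 1) → CQuat := fun a => X a.succ 0 with hz
  have e1 : (Z + quatOuter z z).submatrix Fin.succ Fin.succ = Y + quatOuter v v := by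
    subst hY hv; rfl
  have e2 : (fun a : Fin n => (Z + quatOuter z z) a.succ 0) =
      v' + fun a => v a * star (X 1 0) := by
    subst hv hv'; rfl
  have e3 : ((Z + quatOuter z z) 0 0).re = (X 1 1).re + Quaternion.normSq (X 1 0) := by
    rw [Quaternion.normSq_def]; rfl
  have e4 : Z.submatrix Fin.succ Fin.succ = Y := by subst hY; rfl
  have e5 : (fun a : Fin n => Z a.succ 0) = v' := by subst hv'; rfl
  have e6 : quatOuter v' (fun a => v a * star (X 1 0)) +
      quatOuter (fun a => v a * star (X 1 0)) v' =
      quatOuter v (fun a => v' a * X 1 0) + quatOuter (fun a => v' a * X 1 0) v := by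
    rw [quatOuter_mul_left_eq v v' (star (X 1 0)), quatOuter_mul_left_eq v' v (X 1 0), star_star,
      add_comm]
  -- Affinity writes the derivative along `z z^*` as a difference of two determinants, each of which
  -- can be expanded once more.
  have h1 := (isRankOneAffine (n + 1)).add_quatOuter hZs z
  have h2 := hA.add_quatOuter hYs v
  have h3 := hA.mooreDeriv_polar_add_smul hYs v (fun a => v' a * X 1 0) 1
  have h4 := hA.mooreMixed_self hYs v
  rw [one_smul] at h3
  rw [mooreDet_succ_of_isSelfDual (hZs.add_quatOuter z), e1, e2, e3, h2, quatOuter_add, e6,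
    quatOuter_mul_right, Quaternion.normSq_star, map_add, map_add, map_smul, h3,
    mooreDet_succ_of_isSelfDual hZs, e4, e5] at h1
  rw [mooreDet_succ_of_isSelfDual hX]
  have e7 : (Z 0 0).re = (X 1 1).re := rfl
  rw [e7] at h1
  rw [← hZ, ← hz, mooreDet_succ_of_isSelfDual hZs, e4, e5, e7]
  unfold mooreMixed at h4 ⊢
  linear_combination (norm := module) h1 + Quaternion.normSq (X 1 0) • h4

theorem mooreDet_submatrix_swap_zero_one {n : ℕ}
    {X : Matrix (Fin (n + 2)) (Fin (n + 2)) CQuat} (hX : IsSelfDualKernel X) :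
    mooreDet (X.submatrix (Equiv.swap 0 1) (Equiv.swap 0 1)) = mooreDet X := by
  have hs : ∀ a : Fin n, Equiv.swap (0 : Fin (n + 2)) 1 a.succ.succ = a.succ.succ := fun a =>
    Equiv.swap_apply_of_ne_of_ne (Fin.succ_ne_zero _)
      (fun h => Fin.succ_ne_zero a (Fin.succ_injective _ (h.trans Fin.succ_zero_eq_one.symm)))
  set Y := X.submatrix (fun a : Fin n => a.succ.succ) (fun a : Fin n => a.succ.succ) with hY
  have hYs : IsSelfDualKernel Y := hX.submatrix _
  rw [mooreDet_succ_succ_of_isSelfDual hX Y (fun a : Fin n => X a.succ.succ 0)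
      (fun a : Fin n => X a.succ.succ 1) hY rfl rfl,
    mooreDet_succ_succ_of_isSelfDual (hX.submatrix (Equiv.swap 0 1)) Y
      (fun a : Fin n => X a.succ.succ 1) (fun a : Fin n => X a.succ.succ 0)
      (by ext1 a b; simp [hY, hs]) (by simp [hs]) (by simp [hs])]
  simp only [Matrix.submatrix_apply, Equiv.swap_apply_left, Equiv.swap_apply_right]
  rw [(isRankOneAffine n).mooreMixed_comm hYs (fun a : Fin n => X a.succ.succ 1),
    quatOuter_mul_left_eq _ _ (X 0 1), ← hX 0 1]
  have hN : Quaternion.normSq (X 0 1) = Quaternion.normSq (X 1 0) := by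
    rw [hX 1 0, Quaternion.normSq_star]
  have e : quatOuter (fun a : Fin n => X a.succ.succ 1)
      (fun a => X a.succ.succ 0 * X 0 1) =
      quatOuter (fun a => X a.succ.succ 1 * X 1 0) (fun a => X a.succ.succ 0) := by
    rw [quatOuter_mul_left_eq, ← hX 1 0]
  rw [e, hN]
  simp only [map_add]
  module

/-- Permutations fixing `0` are handled by induction; `swap 0 j` is a conjugate of `swap 0 1` by
such a permutation; together these generate the symmetric group. -/
theorem mooreDet_submatrix_perm {n : ℕ} (σ : Equiv.Perm (Fin n))
    {X : Matrix (Fin n) (Fin n) CQuat} (hX : IsSelfDualKernel X) :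
    mooreDet (X.submatrix σ σ) = mooreDet X := by
  induction n with
  | zero => congr 1; ext1 a; exact a.elim0
  | succ n ih =>
    have hfix : ∀ (e : Equiv.Perm (Fin n)) {X : Matrix (Fin (n + 1)) (Fin (n + 1)) CQuat},
        IsSelfDualKernel X → mooreDet (X.submatrix (Equiv.Perm.decomposeFin.symm (0, e))
          (Equiv.Perm.decomposeFin.symm (0, e))) = mooreDet X := by
      intro e X hX
      rw [mooreDet_succ_of_isSelfDual (hX.submatrix _), mooreDet_succ_of_isSelfDual hX]
      set Y := X.submatrix Fin.succ Fin.succ with hY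
      have hYs : IsSelfDualKernel Y := hX.submatrix _
      set v : Fin n → CQuat := fun a => X a.succ 0 with hv
      have e1 : (X.submatrix (Equiv.Perm.decomposeFin.symm (0, e))
          (Equiv.Perm.decomposeFin.symm (0, e))).submatrix Fin.succ Fin.succ =
          Y.submatrix e e := by
        ext1 a b; simp [hY]
      have e2 : (fun a : Fin n => (X.submatrix (Equiv.Perm.decomposeFin.symm (0, e))
          (Equiv.Perm.decomposeFin.symm (0, e))) a.succ 0) = fun a => v (e a) := by
        funext a; simp [hv]
      have e3 : quatOuter (fun a => v (e a)) (fun a => v (e a)) =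
          (quatOuter v v).submatrix e e := rfl
      -- The rank-one derivative is a difference of determinants of size `n`, so the induction
      -- hypothesis applies to it too.
      have h1 := (isRankOneAffine n).add_quatOuter hYs v
      have h2 := (isRankOneAffine n).add_quatOuter (hYs.submatrix e) (fun a => v (e a))
      have e4 : Y.submatrix e e + (quatOuter v v).submatrix e e =
          (Y + quatOuter v v).submatrix e e := rfl
      rw [e3, e4, ih e (hYs.add_quatOuter v), ih e hYs, h1] at h2
      rw [e1, e2, e3, ih e hYs, ← add_left_cancel h2]
      simp
    have hmul : ∀ (σ τ : Equiv.Perm (Fin (n + 1))),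
        (∀ {X : Matrix (Fin (n + 1)) (Fin (n + 1)) CQuat}, IsSelfDualKernel X →
          mooreDet (X.submatrix σ σ) = mooreDet X) →
        (∀ {X : Matrix (Fin (n + 1)) (Fin (n + 1)) CQuat}, IsSelfDualKernel X →
          mooreDet (X.submatrix τ τ) = mooreDet X) →
        ∀ {X : Matrix (Fin (n + 1)) (Fin (n + 1)) CQuat}, IsSelfDualKernel X →
          mooreDet (X.submatrix ⇑(σ * τ : Equiv.Perm (Fin (n + 1)))
            ⇑(σ * τ : Equiv.Perm (Fin (n + 1)))) = mooreDet X := by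
      intro σ τ hσ hτ X hX
      rw [← hσ hX, ← hτ (hX.submatrix σ)]
      rfl
    have hswap : ∀ (p : Fin (n + 1)) {X : Matrix (Fin (n + 1)) (Fin (n + 1)) CQuat},
        IsSelfDualKernel X →
        mooreDet (X.submatrix (Equiv.swap 0 p) (Equiv.swap 0 p)) = mooreDet X := by
      intro p
      induction p using Fin.cases with
      | zero => intro X _; simp
      | succ j =>
        obtain ⟨k, rfl⟩ : ∃ k, n = k + 1 := ⟨n - 1, by have := j.2; omega⟩
        set ρ : Equiv.Perm (Fin (k + 2)) :=
          Equiv.Perm.decomposeFin.symm (0, Equiv.swap 0 j) with hρ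
        have h0 : ρ 0 = 0 := by simp [hρ]
        have h1 : ρ 1 = j.succ := by
          rw [← Fin.succ_zero_eq_one, hρ, Equiv.Perm.decomposeFin_symm_apply_succ]
          simp
        have hinv : ∀ {X : Matrix (Fin (k + 2)) (Fin (k + 2)) CQuat}, IsSelfDualKernel X →
            mooreDet (X.submatrix ⇑ρ⁻¹ ⇑ρ⁻¹) = mooreDet X := by
          intro X hX
          rw [← hfix (Equiv.swap 0 j) (hX.submatrix ⇑ρ⁻¹), ← hρ]
          congr 1
          ext1 a b
          simp
        have hτ : Equiv.swap 0 j.succ = ρ * Equiv.swap 0 1 * ρ⁻¹ := by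
          rw [← Equiv.swap_apply_apply, h0, h1]
        rw [hτ]
        intro X hX
        exact hmul _ _ (hmul _ _ (hfix (Equiv.swap 0 j)) mooreDet_submatrix_swap_zero_one) hinv hX
    obtain ⟨⟨p, e⟩, rfl⟩ := Equiv.Perm.decomposeFin.symm.surjective σ
    have hσ : Equiv.Perm.decomposeFin.symm (p, e) =
        Equiv.swap 0 p * Equiv.Perm.decomposeFin.symm (0, e) := by
      ext1 a
      induction a using Fin.cases with
      | zero => simp
      | succ a => simp
    rw [hσ]
    exact hmul _ _ (hswap p) (hfix e) hX

/-- An affine function of `c k` is `1 - c k` times its value at `0` plus `c k` times its value at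
`1`; do this for one `k` after another. -/
theorem mooreDet_add_sum_smul_quatOuter {n : ℕ} {ι : Type*} [DecidableEq ι] (S : Finset ι)
    (c : ι → ℂ) (w : ι → Fin n → CQuat) {Y : Matrix (Fin n) (Fin n) CQuat}
    (hY : IsSelfDualKernel Y) :
    mooreDet (Y + ∑ k ∈ S, c k • quatOuter (w k) (w k)) =
      ∑ I ∈ S.powerset, ((∏ k ∈ I, c k) * ∏ k ∈ S \ I, (1 - c k)) •
        mooreDet (Y + ∑ k ∈ I, quatOuter (w k) (w k)) := by
  induction S using Finset.induction_on generalizing Y with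
  | empty => simp
  | insert k S hk ih =>
    rw [Finset.sum_insert hk, ← add_assoc, ih (hY.add_smul_quatOuter _ _),
      Finset.sum_powerset_insert hk, ← Finset.sum_add_distrib]
    refine Finset.sum_congr rfl fun I hI => ?_
    have hkI : k ∉ I := fun h => hk (Finset.mem_powerset.1 hI h)
    have hs : IsSelfDualKernel (Y + ∑ j ∈ I, quatOuter (w j) (w j)) := by
      clear hI hkI
      induction I using Finset.induction_on with
      | empty => simpa using hY
      | insert j I hj ihI =>
        rw [Finset.sum_insert hj, add_left_comm, add_comm]
        exact ihI.add_quatOuter _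
    have h1 := isRankOneAffine n _ hs (w k) (c k)
    have h2 := (isRankOneAffine n).add_quatOuter hs (w k)
    have e1 : insert k S \ I = insert k (S \ I) := Finset.insert_sdiff_of_notMem _ hkI
    have e2 : insert k S \ insert k I = S \ I := by
      rw [Finset.insert_sdiff_insert, Finset.sdiff_insert_of_notMem hk]
    rw [e1, e2, Finset.prod_insert hkI, Finset.prod_insert (by simp [hk]),
      Finset.sum_insert hkI, add_right_comm, h1, add_left_comm, add_comm (quatOuter _ _), h2]
    module

end Symmetry

/-! ### Configurations of finite tuples and their factorial moments -/

section FiniteConfigurations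

variable {Λ : Type*}

open Classical in
/-- The configuration formed by the points of a finite tuple, counted with multiplicity. -/
noncomputable def Configuration.ofTuple [TopologicalSpace Λ] {n : ℕ} (x : Fin n → Λ) :
    Configuration Λ where
  mult z := ∑ i, if x i = z then 1 else 0
  countable_support := by
    refine (Set.finite_range x).countable.mono fun z hz => ?_
    obtain ⟨i, -, hi⟩ := Finset.exists_ne_zero_of_sum_ne_zero hz
    exact ⟨i, by by_contra h; simp [h] at hi⟩
  finite_compact C _ := by
    refine ((Set.finite_range x).subset fun z hz => ?_).inter_of_left C
    obtain ⟨i, -, hi⟩ := Finset.exists_ne_zero_of_sum_ne_zero hz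
    exact ⟨i, by by_contra h; simp [h] at hi⟩

theorem Configuration.count_ofTuple [TopologicalSpace Λ] {n : ℕ} (x : Fin n → Λ) (A : Set Λ) :
    (Configuration.ofTuple x).count A = ∑ i, A.indicator 1 (x i) := by
  classical
  have h : ∀ z, A.indicator (fun y => ((Configuration.ofTuple x).mult y : ℝ≥0∞)) z =
      ∑ i, if z = x i then A.indicator (1 : Λ → ℝ≥0∞) (x i) else 0 := by
    intro z
    by_cases hz : z ∈ A
    · rw [Set.indicator_of_mem hz]
      simp only [Configuration.ofTuple, Nat.cast_sum]
      refine Finset.sum_congr rfl fun i _ => ?_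
      by_cases hi : z = x i
      · subst hi; simp [hz]
      · rw [if_neg hi, if_neg (fun h => hi h.symm), Nat.cast_zero]
    · rw [Set.indicator_of_notMem hz]
      refine (Finset.sum_eq_zero fun i _ => ?_).symm
      by_cases hi : z = x i
      · subst hi; simp [hz]
      · rw [if_neg hi]
  unfold Configuration.count
  simp_rw [h]
  rw [Summable.tsum_finsetSum fun _ _ => ENNReal.summable]
  exact Finset.sum_congr rfl fun i _ => tsum_ite_eq _ _

open Classical in
theorem Configuration.count_ofTuple_eq_card [TopologicalSpace Λ] {n : ℕ} (x : Fin n → Λ)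
    (A : Set Λ) :
    (Configuration.ofTuple x).count A = (Fintype.card {j // x j ∈ A} : ℕ) := by
  rw [Configuration.count_ofTuple, Fintype.card_subtype, Finset.card_filter, Nat.cast_sum]
  refine Finset.sum_congr rfl fun i _ => ?_
  by_cases h : x i ∈ A <;> simp [h]

theorem Configuration.measurable_count [TopologicalSpace Λ] [MeasurableSpace Λ] {A : Set Λ}
    (hA : MeasurableSet A) : Measurable fun ξ : Configuration Λ => ξ.count A :=
  (comap_measurable (fun ξ : Configuration Λ => ξ.count A)).mono
    (le_iSup (fun A : {A : Set Λ // MeasurableSet A} =>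
      MeasurableSpace.comap (fun ξ : Configuration Λ => ξ.count A.1) inferInstance) ⟨A, hA⟩) le_rfl

theorem Configuration.measurable_ofTuple [TopologicalSpace Λ] [MeasurableSpace Λ] {n : ℕ} :
    Measurable (Configuration.ofTuple : (Fin n → Λ) → Configuration Λ) := by
  rw [measurable_iff_comap_le]
  change MeasurableSpace.comap _ (⨆ A : {A : Set Λ // MeasurableSet A}, _) ≤ _
  rw [MeasurableSpace.comap_iSup]
  refine iSup_le fun A => ?_
  rw [MeasurableSpace.comap_comp, ← measurable_iff_comap_le]
  have : (fun ξ : Configuration Λ => ξ.count A.1) ∘ Configuration.ofTuple =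
      fun x : Fin n → Λ => ∑ i, (A.1).indicator 1 (x i) := by
    funext x; exact Configuration.count_ofTuple x A.1
  rw [this]
  exact Finset.measurable_sum _ fun i _ =>
    (measurable_one.indicator A.2).comp (measurable_pi_apply i)

theorem fallingFactorial_natCast (c k : ℕ) :
    fallingFactorial (c : ℝ≥0∞) k = (c.descFactorial k : ℕ) := by
  rw [fallingFactorial, Nat.descFactorial_eq_prod_range, Nat.cast_prod]
  exact Finset.prod_congr rfl fun j _ => (ENNReal.natCast_sub c j).symm

theorem measurable_fallingFactorial (k : ℕ) : Measurable fun n : ℝ≥0∞ => fallingFactorial n k :=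
  Finset.measurable_prod _ fun _ _ => measurable_id.sub_const _

/-- Embeddings of a disjoint union that respect a disjoint family of subsets. -/
noncomputable def sigmaEmbeddingEquiv {ι β : Type*} {α : ι → Type*} (S : ι → Set β)
    (hS : Pairwise (fun i j => Disjoint (S i) (S j))) :
    {φ : (Σ i, α i) ↪ β // ∀ i j, φ ⟨i, j⟩ ∈ S i} ≃ ((i : ι) → (α i ↪ S i)) where
  toFun φ i := ⟨fun j => ⟨φ.1 ⟨i, j⟩, φ.2 i j⟩, fun j j' h => by
    have := φ.1.injective (Subtype.ext_iff.1 h)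
    simpa using this⟩
  invFun ψ := ⟨⟨fun p => (ψ p.1 p.2 : β), by
    rintro ⟨i, j⟩ ⟨i', j'⟩ h
    by_cases hi : i = i'
    · subst hi
      have := (ψ i).injective (Subtype.ext h)
      simpa using this
    · exact absurd h (Set.disjoint_iff_forall_ne.1 (hS hi) (ψ i j).2 (ψ i' j').2)⟩,
    fun i j => (ψ i j).2⟩
  left_inv φ := rfl
  right_inv ψ := rfl

theorem measurableSet_blockBox [MeasurableSpace Λ] {m k : ℕ} {A : Fin m → Set Λ} {n : Fin m → ℕ}
    (hk : ∑ i, n i = k) (hA : ∀ i, MeasurableSet (A i)) : MeasurableSet (blockBox A n hk) := by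
  have : blockBox A n hk = ⋂ (i : Fin m) (j : Fin (n i)),
      (fun x : Fin k → Λ => x (Fin.cast hk (finSigmaFinEquiv ⟨i, j⟩))) ⁻¹' A i := by
    ext x; simp [blockBox]
  rw [this]
  exact MeasurableSet.iInter fun i => MeasurableSet.iInter fun j => measurable_pi_apply _ (hA i)

/-- Both sides count the injections of the `k` slots into the points of `x` that send every slot
into its prescribed set. Disjointness makes separately chosen injections jointly injective. -/
theorem prod_fallingFactorial_count_ofTuple [TopologicalSpace Λ] {N m k : ℕ} (x : Fin N → Λ)
    (A : Fin m → Set Λ) (n : Fin m → ℕ) (hk : ∑ i, n i = k)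
    (hA : Pairwise (fun i j => Disjoint (A i) (A j))) :
    ∏ i, fallingFactorial ((Configuration.ofTuple x).count (A i)) (n i) =
      ∑ φ : Fin k ↪ Fin N, (blockBox A n hk).indicator 1 (x ∘ φ) := by
  classical
  subst hk
  have hS : Pairwise (fun i j => Disjoint (x ⁻¹' A i) (x ⁻¹' A j)) :=
    fun i j hij => (hA hij).preimage x
  have h1 : ∏ i, fallingFactorial ((Configuration.ofTuple x).count (A i)) (n i) =
      (Fintype.card ((i : Fin m) → (Fin (n i) ↪ (x ⁻¹' A i))) : ℕ) := by
    rw [Fintype.card_pi, Nat.cast_prod]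
    refine Finset.prod_congr rfl fun i _ => ?_
    rw [Configuration.count_ofTuple_eq_card, fallingFactorial_natCast, Fintype.card_embedding_eq,
      Fintype.card_fin]
    congr!
  rw [h1, ← Fintype.card_congr (sigmaEmbeddingEquiv (fun i => x ⁻¹' A i) hS),
    Fintype.card_subtype, Finset.card_filter, Nat.cast_sum]
  refine Fintype.sum_equiv (Equiv.embeddingCongr finSigmaFinEquiv (Equiv.refl _)) _ _ fun φ => ?_
  have : (∀ i j, φ ⟨i, j⟩ ∈ x ⁻¹' A i) ↔
      x ∘ (Equiv.embeddingCongr finSigmaFinEquiv (Equiv.refl _)) φ ∈ blockBox A n rfl := by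
    simp [blockBox, Equiv.embeddingCongr]
  by_cases h : ∀ i j, φ ⟨i, j⟩ ∈ x ⁻¹' A i
  · rw [if_pos h, Set.indicator_of_mem (this.1 h)]; simp
  · rw [if_neg h, Set.indicator_of_notMem (fun h' => h (this.2 h'))]; simp

end FiniteConfigurations

/-! ### From Dyson's integration relation to a point field -/

section DysonFamily

variable {Λ : Type*} [MeasurableSpace Λ]

/-- A family of symmetric functions `ρ_m` on `Λ^m` with `ρ_0 = 1` that satisfies Dyson's
integration relation `∫ ρ_{m+1}(y, x) dμ(y) = (n - m) ρ_m(x)`. -/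
structure IsDysonFamily (μ : Measure Λ) (n : ℕ) (ρ : ∀ m, (Fin m → Λ) → ℝ≥0∞) : Prop where
  measurable : ∀ m, Measurable (ρ m)
  symm : ∀ m (σ : Equiv.Perm (Fin m)) (x : Fin m → Λ), ρ m (x ∘ σ) = ρ m x
  zero : ∀ x, ρ 0 x = 1
  lintegral_cons : ∀ m (x : Fin m → Λ),
    ∫⁻ y, ρ (m + 1) (Fin.cons y x : Fin (m + 1) → Λ) ∂μ = ((n - m : ℕ) : ℝ≥0∞) * ρ m x

theorem lintegral_pi_fin_succ (μ : Measure Λ) [SigmaFinite μ] {m : ℕ}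
    {f : (Fin (m + 1) → Λ) → ℝ≥0∞} (hf : Measurable f) :
    ∫⁻ x, f x ∂(Measure.pi fun _ => μ) =
      ∫⁻ x : Fin m → Λ, ∫⁻ y, f (Fin.cons y x : Fin (m + 1) → Λ) ∂μ ∂(Measure.pi fun _ => μ) := by
  have h := (measurePreserving_piFinSuccAbove (fun _ : Fin (m + 1) => μ) 0).symm
  rw [← h.lintegral_comp hf, lintegral_prod_symm']
  · exact lintegral_congr fun x => lintegral_congr fun y => congrArg f (Fin.insertNth_zero' y x)
  · exact hf.comp (MeasurableEquiv.measurable _)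

theorem measurePreserving_comp_perm (μ : Measure Λ) [SigmaFinite μ] {m : ℕ}
    (σ : Equiv.Perm (Fin m)) :
    MeasurePreserving (fun x : Fin m → Λ => x ∘ σ) (Measure.pi fun _ => μ)
      (Measure.pi fun _ => μ) := by
  have h := (measurePreserving_piCongrLeft (fun _ : Fin m => μ) σ).symm
  exact h

namespace IsDysonFamily

variable {μ : Measure Λ} [SigmaFinite μ] {n : ℕ} {ρ : ∀ m, (Fin m → Λ) → ℝ≥0∞}

theorem lintegral_eq (h : IsDysonFamily μ n ρ) (m : ℕ) :
    ∫⁻ x, ρ m x ∂(Measure.pi fun _ => μ) = (n.descFactorial m : ℕ) := by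
  induction m with
  | zero => simp [h.zero]
  | succ m ih =>
    rw [lintegral_pi_fin_succ μ (h.measurable _)]
    simp_rw [h.lintegral_cons]
    rw [lintegral_const_mul _ (h.measurable _), ih, Nat.descFactorial_succ, Nat.cast_mul]

/-- The first `j` variables are integrated out one at a time; passing from `k + i + 1` to `k + i`
points yields the factor `n - (k + i)`. -/
theorem lintegral_addNat (h : IsDysonFamily μ n ρ) {k : ℕ} {g : (Fin k → Λ) → ℝ≥0∞}
    (hg : Measurable g) (j : ℕ) :
    ∫⁻ x : Fin (k + j) → Λ, g (fun i => x (i.addNat j)) * ρ (k + j) x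
        ∂(Measure.pi fun _ => μ) =
      ((n - k).descFactorial j : ℕ) * ∫⁻ x, g x * ρ k x ∂(Measure.pi fun _ => μ) := by
  have hm : ∀ j, Measurable fun x : Fin (k + j) → Λ =>
      g (fun i => x (i.addNat j)) * ρ (k + j) x := fun j =>
    (hg.comp (measurable_pi_lambda _ fun i => measurable_pi_apply _)).mul (h.measurable _)
  induction j with
  | zero =>
    simp only [Nat.descFactorial_zero, Nat.cast_one, one_mul]
    rfl
  | succ j ih =>
    have h1 := lintegral_pi_fin_succ μ (hm (j + 1))
    have h2 : ∀ (x : Fin (k + j) → Λ) (y : Λ),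
        (fun i : Fin k => (Fin.cons y x : Fin (k + j + 1) → Λ) (i.addNat (j + 1))) =
          fun i => x (i.addNat j) := fun x y => rfl
    refine h1.trans ?_
    have h3 : ∀ x : Fin (k + j) → Λ, ∫⁻ y, g (fun i : Fin k =>
          (Fin.cons y x : Fin (k + j + 1) → Λ) (i.addNat (j + 1))) *
          ρ (k + j + 1) (Fin.cons y x : Fin (k + j + 1) → Λ) ∂μ =
        ((n - (k + j) : ℕ) : ℝ≥0∞) * (g (fun i => x (i.addNat j)) * ρ (k + j) x) := by
      intro x
      simp_rw [h2]
      rw [lintegral_const_mul, h.lintegral_cons, mul_left_comm]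
      refine (h.measurable _).comp (measurable_pi_lambda _ fun i => ?_)
      induction i using Fin.cases with
      | zero => exact measurable_id
      | succ i => exact measurable_const
    refine (lintegral_congr h3).trans ?_
    refine (lintegral_const_mul _ (hm j)).trans ((congrArg _ ih).trans ?_)
    rw [Nat.descFactorial_succ, Nat.cast_mul, mul_assoc, Nat.sub_sub]

/-- Integrating out all but the points selected by an injection. -/
theorem lintegral_embedding (h : IsDysonFamily μ n ρ) {k : ℕ} (φ : Fin k ↪ Fin n)
    {g : (Fin k → Λ) → ℝ≥0∞} (hg : Measurable g) :
    ∫⁻ x, g (x ∘ φ) * ρ n x ∂(Measure.pi fun _ => μ) =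
      ((n - k).factorial : ℕ) * ∫⁻ x, g x * ρ k x ∂(Measure.pi fun _ => μ) := by
  have hkn : k ≤ n := by simpa using Fintype.card_le_of_embedding φ
  obtain ⟨j, rfl⟩ := Nat.exists_eq_add_of_le hkn
  -- Symmetry of `ρ n` allows the selected coordinates to be moved to the last `k` places.
  obtain ⟨σ, hσ⟩ := Equiv.Perm.exists_extending_pair (fun i : Fin k => i.addNat j) φ
    (fun a b hab => by simpa using hab) φ.injective
  have h1 := h.lintegral_addNat hg j
  rw [← (measurePreserving_comp_perm μ σ).lintegral_comp] at h1
  · simp only [Function.comp_apply] at h1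
    have h2 : ∀ x : Fin (k + j) → Λ, (fun i : Fin k => x (σ (i.addNat j))) = x ∘ φ := by
      intro x; funext i; exact congrArg x (hσ i)
    simp_rw [h2, h.symm] at h1
    rw [h1, Nat.add_sub_cancel_left, Nat.descFactorial_self]
  · exact (hg.comp (measurable_pi_lambda _ fun i => measurable_pi_apply _)).mul (h.measurable _)

/-- The law is that of `n` points with joint density `ρ n / n!`. Each of the `n! / (n - k)!`
injections contributes `(n - k)!` times the integral of `ρ k`, which cancels the normalization. -/
theorem exists_pointField [TopologicalSpace Λ] (h : IsDysonFamily μ n ρ) :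
    ∃ P : Measure (Configuration Λ), IsProbabilityMeasure P ∧
      ∀ (k m : ℕ) (A : Fin m → Set Λ) (c : Fin m → ℕ) (hk : ∑ i, c i = k),
        (∀ i, MeasurableSet (A i)) → Pairwise (fun i j => Disjoint (A i) (A j)) →
        ∫⁻ ξ, ∏ i, fallingFactorial (ξ.count (A i)) (c i) ∂P =
          ∫⁻ x in blockBox A c hk, ρ k x ∂(Measure.pi fun _ => μ) := by
  have hn0 : ((n.factorial : ℕ) : ℝ≥0∞) ≠ 0 := by exact_mod_cast n.factorial_ne_zero
  have hnt : ((n.factorial : ℕ) : ℝ≥0∞) ≠ ∞ := ENNReal.natCast_ne_top _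
  set ν : Measure (Fin n → Λ) :=
    ((n.factorial : ℕ) : ℝ≥0∞)⁻¹ • (Measure.pi fun _ => μ).withDensity (ρ n) with hν
  have hνp : IsProbabilityMeasure ν := by
    constructor
    rw [hν, Measure.smul_apply, withDensity_apply _ MeasurableSet.univ, Measure.restrict_univ,
      h.lintegral_eq, Nat.descFactorial_self, smul_eq_mul, ENNReal.inv_mul_cancel hn0 hnt]
  refine ⟨ν.map Configuration.ofTuple,
    Measure.isProbabilityMeasure_map Configuration.measurable_ofTuple.aemeasurable, ?_⟩
  intro k m A c hk hA hdis
  have hbox := measurableSet_blockBox hk hA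
  have hg : Measurable ((blockBox A c hk).indicator (1 : (Fin k → Λ) → ℝ≥0∞)) :=
    measurable_one.indicator hbox
  have hgφ : ∀ φ : Fin k ↪ Fin n, Measurable fun x : Fin n → Λ =>
      (blockBox A c hk).indicator (1 : (Fin k → Λ) → ℝ≥0∞) (x ∘ φ) := fun φ =>
    hg.comp (measurable_pi_lambda _ fun i => measurable_pi_apply _)
  have hF : Measurable fun ξ : Configuration Λ =>
      ∏ i, fallingFactorial (ξ.count (A i)) (c i) :=
    Finset.measurable_prod _ fun i _ => (measurable_fallingFactorial _).comp
      (Configuration.measurable_count (hA i))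
  rw [lintegral_map hF Configuration.measurable_ofTuple]
  simp_rw [prod_fallingFactorial_count_ofTuple _ A c hk hdis]
  rw [hν, lintegral_smul_measure, lintegral_withDensity_eq_lintegral_mul _ (h.measurable n)
    (Finset.measurable_sum _ fun φ _ => hgφ φ)]
  have h1 : ∫⁻ x, (ρ n * fun x => ∑ φ : Fin k ↪ Fin n,
        (blockBox A c hk).indicator (1 : (Fin k → Λ) → ℝ≥0∞) (x ∘ φ)) x
        ∂(Measure.pi fun _ => μ) =
      ∑ φ : Fin k ↪ Fin n, ∫⁻ x, (blockBox A c hk).indicator (1 : (Fin k → Λ) → ℝ≥0∞) (x ∘ φ) *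
        ρ n x ∂(Measure.pi fun _ => μ) := by
    refine Eq.trans (lintegral_congr fun x => ?_)
      (lintegral_finsetSum _ fun φ _ => (hgφ φ).mul (h.measurable n))
    rw [Pi.mul_apply, mul_comm, Finset.sum_mul]
  have h2 : ∫⁻ x, (blockBox A c hk).indicator (1 : (Fin k → Λ) → ℝ≥0∞) x * ρ k x
        ∂(Measure.pi fun _ => μ) = ∫⁻ x in blockBox A c hk, ρ k x ∂(Measure.pi fun _ => μ) := by
    rw [← lintegral_indicator hbox]
    refine lintegral_congr fun x => ?_
    by_cases hx : x ∈ blockBox A c hk <;> simp [hx]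
  rw [h1]
  simp_rw [h.lintegral_embedding _ hg, h2]
  rw [Finset.sum_const, Finset.card_univ, Fintype.card_embedding_eq, Fintype.card_fin,
    Fintype.card_fin, nsmul_eq_mul, smul_eq_mul]
  by_cases hkn : k ≤ n
  · rw [← mul_assoc, ← mul_assoc, mul_assoc _ ((n.descFactorial k : ℕ) : ℝ≥0∞), ← Nat.cast_mul,
      mul_comm (n.descFactorial k), Nat.factorial_mul_descFactorial hkn,
      ENNReal.inv_mul_cancel hn0 hnt, one_mul]
  -- For `k > n` there are no injections, and `ρ k` has total integral zero.
  · have h0 : n.descFactorial k = 0 := Nat.descFactorial_eq_zero_iff_lt.2 (not_le.1 hkn)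
    have h3 : ∫⁻ x in blockBox A c hk, ρ k x ∂(Measure.pi fun _ => μ) = 0 := by
      refine le_antisymm ((setLIntegral_le_lintegral _ _).trans ?_) bot_le
      rw [h.lintegral_eq, h0, Nat.cast_zero]
    rw [h3, mul_zero, mul_zero, mul_zero]

end IsDysonFamily
end DysonFamily

/-! ### Dyson's relation for projection kernels -/

section KernelIntegration

variable {Λ : Type*}

/-- The real part of the scalar component of `Det_M (K (x i) (x j))`. -/
noncomputable def kernelDet (K : Λ → Λ → CQuat) {m : ℕ} (x : Fin m → Λ) : ℝ :=
  (mooreDet (kernelMatrix K x)).re.re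

theorem IsPositiveKernel.mooreDet_eq {K : Λ → Λ → CQuat} (hK : IsPositiveKernel K) {m : ℕ}
    (x : Fin m → Λ) :
    0 ≤ kernelDet K x ∧ mooreDet (kernelMatrix K x) = ((kernelDet K x : ℂ) : CQuat) := by
  unfold kernelDet
  -- Positivity is assumed only for `m ≥ 1`; the empty determinant is `1`.
  rcases Nat.eq_zero_or_pos m with rfl | hm
  · rw [mooreDet_fin_zero]
    change (0 : ℝ) ≤ (1 : ℂ).re ∧ (1 : CQuat) = (((1 : ℂ).re : ℂ) : CQuat)
    rw [Complex.one_re, Complex.ofReal_one, Quaternion.coe_one]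
    exact ⟨zero_le_one, rfl⟩
  · obtain ⟨r, hr, h⟩ := hK m hm x
    rw [h]
    simpa using hr

theorem isSelfDualKernel_partialKernel {ι : Type*} (u : ι → Λ → CQuat) (I : Finset ι) :
    IsSelfDualKernel (partialKernel u I) := by
  classical
  intro x y
  unfold partialKernel
  induction I using Finset.induction_on with
  | empty => exact (star_zero CQuat).symm
  | insert i I hi ih =>
    rw [Finset.sum_insert hi, Finset.sum_insert hi, CQuat.star_add, ih, star_mul, star_star]

theorem IsSelfDualKernel.kernelMatrix {K : Λ → Λ → CQuat} (hK : IsSelfDualKernel K) {m : ℕ}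
    (x : Fin m → Λ) : IsSelfDualKernel (kernelMatrix K x) :=
  fun a b => hK (x a) (x b)

theorem kernelDet_comp_perm {K : Λ → Λ → CQuat} (hK : IsSelfDualKernel K) {m : ℕ}
    (σ : Equiv.Perm (Fin m)) (x : Fin m → Λ) : kernelDet K (x ∘ σ) = kernelDet K x := by
  unfold kernelDet
  rw [← mooreDet_submatrix_perm σ (hK.kernelMatrix x)]
  rfl

theorem kernelMatrix_partialKernel {ι : Type*} (u : ι → Λ → CQuat) (I : Finset ι) {m : ℕ}
    (x : Fin m → Λ) :
    kernelMatrix (partialKernel u I) x = ∑ k ∈ I, quatOuter (u k ∘ x) (u k ∘ x) := by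
  ext1 a b
  rw [Matrix.sum_apply]
  rfl

/-- The scalar component as a linear form. -/
noncomputable def CQuat.reLinear : CQuat →ₗ[ℂ] ℂ where
  toFun q := q.re
  map_add' _ _ := rfl
  map_smul' _ _ := rfl

/-- The linear map `q ↦ (w_a q z_b^*)`. -/
noncomputable def quatSandwich {n : ℕ} (w z : Fin n → CQuat) :
    CQuat →ₗ[ℂ] Matrix (Fin n) (Fin n) CQuat where
  toFun q := Matrix.of fun a b => w a * q * star (z b)
  map_add' p q := by ext1 a b; simp [mul_add, add_mul]
  map_smul' c q := by
    ext1 a b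
    change w a * (c • q) * star (z b) = c • (w a * q * star (z b))
    rw [mul_smul_comm, smul_mul_assoc]

theorem CQuat.linearForm_apply (l : CQuat →ₗ[ℂ] ℂ) (q : CQuat) :
    l q = q.re * l ⟨1, 0, 0, 0⟩ + q.imI * l ⟨0, 1, 0, 0⟩ + q.imJ * l ⟨0, 0, 1, 0⟩ +
      q.imK * l ⟨0, 0, 0, 1⟩ := by
  have h : q = q.re • (⟨1, 0, 0, 0⟩ : CQuat) + q.imI • (⟨0, 1, 0, 0⟩ : CQuat) +
      q.imJ • (⟨0, 0, 1, 0⟩ : CQuat) + q.imK • (⟨0, 0, 0, 1⟩ : CQuat) := by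
    apply Quaternion.ext
    · change q.re = q.re * 1 + q.imI * 0 + q.imJ * 0 + q.imK * 0
      ring
    · change q.imI = q.re * 0 + q.imI * 1 + q.imJ * 0 + q.imK * 0
      ring
    · change q.imJ = q.re * 0 + q.imI * 0 + q.imJ * 1 + q.imK * 0
      ring
    · change q.imK = q.re * 0 + q.imI * 0 + q.imJ * 0 + q.imK * 1
      ring
  have hl : ∀ (a b c d : ℂ) (x y z w : CQuat), l (a • x + b • y + c • z + d • w) =
      a * l x + b * l y + c * l z + d * l w := by
    intros
    simp only [map_add, map_smul, smul_eq_mul]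
  exact (congrArg l h).trans (hl _ _ _ _ _ _ _ _)

variable [MeasurableSpace Λ]

theorem HasQuatIntegral.linearForm {μ : Measure Λ} {f : Λ → CQuat} {q : CQuat}
    (h : HasQuatIntegral μ f q) (l : CQuat →ₗ[ℂ] ℂ) :
    Integrable (fun x => l (f x)) μ ∧ ∫ x, l (f x) ∂μ = l q := by
  simp_rw [CQuat.linearForm_apply l]
  have h1 := h.integrable_re.mul_const (l ⟨1, 0, 0, 0⟩)
  have h2 := h.integrable_imI.mul_const (l ⟨0, 1, 0, 0⟩)
  have h3 := h.integrable_imJ.mul_const (l ⟨0, 0, 1, 0⟩)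
  have h4 := h.integrable_imK.mul_const (l ⟨0, 0, 0, 1⟩)
  have h12 : Integrable (fun x => (f x).re * l ⟨1, 0, 0, 0⟩ + (f x).imI * l ⟨0, 1, 0, 0⟩) μ :=
    h1.add h2
  have h123 : Integrable (fun x => (f x).re * l ⟨1, 0, 0, 0⟩ + (f x).imI * l ⟨0, 1, 0, 0⟩ +
      (f x).imJ * l ⟨0, 0, 1, 0⟩) μ := h12.add h3
  refine ⟨h123.add h4, ?_⟩
  rw [integral_add h123 h4, integral_add h12 h3, integral_add h1 h2,
    integral_mul_const, integral_mul_const, integral_mul_const, integral_mul_const,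
    h.integral_re, h.integral_imI, h.integral_imJ, h.integral_imK]

/-- Expand at the index of `y`. The scalar `K(y, y)` integrates to `|I|`, and `∫ K(x_a, y) K(y, x_b)
dy = K(x_a, x_b)` turns the derivative term into `D_Y(Y) = m Det Y`. -/
theorem IsOrthonormalSystem.integral_kernelDet_cons {ι : Type*} [DecidableEq ι] {μ : Measure Λ}
    {u : ι → Λ → CQuat} (hu : IsOrthonormalSystem μ u) (I : Finset ι) {m : ℕ} (x : Fin m → Λ) :
    Integrable (fun y => kernelDet (partialKernel u I) (Fin.cons y x : Fin (m + 1) → Λ)) μ ∧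
      ∫ y, kernelDet (partialKernel u I) (Fin.cons y x : Fin (m + 1) → Λ) ∂μ =
        ((I.card : ℝ) - m) * kernelDet (partialKernel u I) x := by
  set K := partialKernel u I with hK
  have hKs : IsSelfDualKernel K := isSelfDualKernel_partialKernel u I
  set Y := kernelMatrix K x with hY
  set d : ℂ := (mooreDet Y).re with hd
  -- In `K(x_a, y) K(y, x_b)` the variable `y` enters only through `u_k(y)^* u_l(y)`, to which a
  -- linear form is applied, so orthonormality suffices to integrate.
  set L : ι → ι → CQuat →ₗ[ℂ] ℂ := fun k l =>
    CQuat.reLinear ∘ₗ mooreDeriv Y ∘ₗ quatSandwich (u k ∘ x) (u l ∘ x) with hL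
  set F : Λ → ℂ := fun y =>
    (mooreDet (kernelMatrix K (Fin.cons y x : Fin (m + 1) → Λ))).re with hF
  have hrec : ∀ y, F y = (∑ k ∈ I, CQuat.reLinear (star (u k y) * u k y)) * d -
      ∑ k ∈ I, ∑ l ∈ I, L k l (star (u k y) * u l y) := by
    intro y
    have h1 := mooreDet_succ_of_isSelfDual (hKs.kernelMatrix (Fin.cons y x : Fin (m + 1) → Λ))
    have h2 : (kernelMatrix K (Fin.cons y x : Fin (m + 1) → Λ)).submatrix Fin.succ Fin.succ = Y :=
      rfl
    have h3 : (kernelMatrix K (Fin.cons y x : Fin (m + 1) → Λ) 0 0).re =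
        ∑ k ∈ I, CQuat.reLinear (star (u k y) * u k y) := by
      have : kernelMatrix K (Fin.cons y x : Fin (m + 1) → Λ) 0 0 =
          ∑ k ∈ I, star (u k y) * u k y :=
        -- Both `u u^*` and `u^* u` equal the complex scalar `normSq u`.
        Finset.sum_congr rfl fun k _ =>
          (Quaternion.self_mul_star (u k y)).trans (Quaternion.star_mul_self (u k y)).symm
      rw [← map_sum, ← this]
      rfl
    have h4 : quatOuter (fun a : Fin m => kernelMatrix K (Fin.cons y x : Fin (m + 1) → Λ) a.succ 0)
        (fun a : Fin m => kernelMatrix K (Fin.cons y x : Fin (m + 1) → Λ) a.succ 0) =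
        ∑ k ∈ I, ∑ l ∈ I, quatSandwich (u k ∘ x) (u l ∘ x) (star (u k y) * u l y) := by
      ext1 a b
      have e1 : quatOuter
          (fun a : Fin m => kernelMatrix K (Fin.cons y x : Fin (m + 1) → Λ) a.succ 0)
          (fun a : Fin m => kernelMatrix K (Fin.cons y x : Fin (m + 1) → Λ) a.succ 0) a b =
          K (x a) y * K y (x b) := by
        rw [hKs (x b) y]; rfl
      rw [e1, Matrix.sum_apply, hK]
      unfold partialKernel
      rw [Finset.sum_mul_sum]
      refine Finset.sum_congr rfl fun k _ => ?_
      rw [Matrix.sum_apply]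
      refine Finset.sum_congr rfl fun l _ => ?_
      simp [quatSandwich, mul_assoc]
    rw [h2, h3, h4] at h1
    have h5 := congrArg CQuat.reLinear h1
    rw [map_sub, map_smul, map_sum, map_sum] at h5
    simp only [map_sum] at h5 ⊢
    exact h5
  have hre : ∀ k, Integrable (fun y => CQuat.reLinear (star (u k y) * u k y)) μ ∧
      ∫ y, CQuat.reLinear (star (u k y) * u k y) ∂μ = 1 := fun k => by
    have := (hu.hasIntegral k k).linearForm CQuat.reLinear
    rw [if_pos rfl] at this
    exact this
  have hLi : ∀ k l, Integrable (fun y => L k l (star (u k y) * u l y)) μ ∧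
      ∫ y, L k l (star (u k y) * u l y) ∂μ = L k l (if k = l then 1 else 0) := fun k l =>
    (hu.hasIntegral k l).linearForm (L k l)
  have hi1 : Integrable (fun y => (∑ k ∈ I, CQuat.reLinear (star (u k y) * u k y)) * d) μ :=
    (integrable_finsetSum _ fun k _ => (hre k).1).mul_const d
  have hi2 : ∀ k ∈ I, Integrable (fun y => ∑ l ∈ I, L k l (star (u k y) * u l y)) μ := fun k _ =>
    integrable_finsetSum _ fun l _ => (hLi k l).1
  have hi3 : Integrable (fun y => ∑ k ∈ I, ∑ l ∈ I, L k l (star (u k y) * u l y)) μ :=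
    integrable_finsetSum _ hi2
  have hFi : Integrable F μ := by
    rw [show F = _ from funext hrec]
    exact hi1.sub hi3
  have hdiag : ∑ k ∈ I, ∑ l ∈ I, L k l (if k = l then 1 else 0) = (m : ℂ) * d := by
    have : ∀ k ∈ I, ∑ l ∈ I, L k l (if k = l then 1 else 0) =
        CQuat.reLinear (mooreDeriv Y (quatOuter (u k ∘ x) (u k ∘ x))) := by
      intro k hk
      rw [Finset.sum_eq_single k]
      · rw [if_pos rfl]
        have : quatSandwich (u k ∘ x) (u k ∘ x) 1 = quatOuter (u k ∘ x) (u k ∘ x) := by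
          ext1 a b; simp [quatSandwich, quatOuter_apply]
        rw [← this]
        rfl
      · intro l _ hl
        rw [if_neg hl.symm, map_zero]
      · exact fun h => absurd hk h
    rw [Finset.sum_congr rfl this, ← map_sum, ← map_sum, ← kernelMatrix_partialKernel, ← hK, ← hY,
      mooreDeriv_self, map_smul]
    rfl
  have hFint : ∫ y, F y ∂μ = ((I.card : ℂ) - m) * d := by
    rw [show F = _ from funext hrec, integral_sub hi1 hi3, integral_mul_const,
      integral_finsetSum _ fun k _ => (hre k).1, integral_finsetSum _ hi2,
      Finset.sum_congr rfl fun k _ => (hre k).2,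
      Finset.sum_congr rfl fun k _ => integral_finsetSum I fun l _ => (hLi k l).1]
    simp_rw [(hLi _ _).2]
    rw [hdiag, Finset.sum_const, nsmul_eq_mul, mul_one, sub_mul]
  refine ⟨hFi.re, ?_⟩
  have := integral_re hFi
  refine this.trans ?_
  rw [hFint]
  change (((I.card : ℂ) - m) * d).re = _ * d.re
  simp

/-! ### Measurability of the determinants, and the Dyson family of a projection kernel -/

theorem QuatMeasurable.const (q : CQuat) : QuatMeasurable fun _ : Λ => q :=
  ⟨measurable_const, measurable_const, measurable_const, measurable_const⟩

theorem QuatMeasurable.add {f g : Λ → CQuat} (hf : QuatMeasurable f) (hg : QuatMeasurable g) :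
    QuatMeasurable fun x => f x + g x :=
  ⟨hf.re.add hg.re, hf.imI.add hg.imI, hf.imJ.add hg.imJ, hf.imK.add hg.imK⟩

theorem QuatMeasurable.mul {f g : Λ → CQuat} (hf : QuatMeasurable f) (hg : QuatMeasurable g) :
    QuatMeasurable fun x => f x * g x := by
  have f1 := hf.re
  have f2 := hf.imI
  have f3 := hf.imJ
  have f4 := hf.imK
  have g1 := hg.re
  have g2 := hg.imI
  have g3 := hg.imJ
  have g4 := hg.imK
  constructor
  · simp only [Quaternion.re_mul]; fun_prop
  · simp only [Quaternion.imI_mul]; fun_prop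
  · simp only [Quaternion.imJ_mul]; fun_prop
  · simp only [Quaternion.imK_mul]; fun_prop

theorem QuatMeasurable.star {f : Λ → CQuat} (hf : QuatMeasurable f) :
    QuatMeasurable fun x => star (f x) := by
  have f2 := hf.imI
  have f3 := hf.imJ
  have f4 := hf.imK
  constructor
  · simpa using hf.re
  · simpa using f2
  · simpa using f3
  · simpa using f4

theorem QuatMeasurable.sum {ι : Type*} (s : Finset ι) {f : ι → Λ → CQuat}
    (hf : ∀ i ∈ s, QuatMeasurable (f i)) : QuatMeasurable fun x => ∑ i ∈ s, f i x := by
  classical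
  induction s using Finset.induction_on with
  | empty => simpa using QuatMeasurable.const 0
  | insert i s hi ih =>
    simp_rw [Finset.sum_insert hi]
    exact (hf i (Finset.mem_insert_self i s)).add
      (ih fun j hj => hf j (Finset.mem_insert_of_mem hj))

theorem QuatMeasurable.listProd {ι : Type*} (l : List ι) {f : ι → Λ → CQuat}
    (hf : ∀ i, QuatMeasurable (f i)) : QuatMeasurable fun x => (l.map fun i => f i x).prod := by
  induction l with
  | nil => simpa using QuatMeasurable.const 1
  | cons i l ih =>
    simp_rw [List.map_cons, List.prod_cons]
    exact (hf i).mul ih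

theorem QuatMeasurable.comp {Λ' : Type*} [MeasurableSpace Λ'] {f : Λ → CQuat}
    (hf : QuatMeasurable f) {g : Λ' → Λ} (hg : Measurable g) : QuatMeasurable fun x => f (g x) :=
  ⟨hf.re.comp hg, hf.imI.comp hg, hf.imJ.comp hg, hf.imK.comp hg⟩

theorem QuatMeasurable.mooreDet {n : ℕ} {X : Λ → Matrix (Fin n) (Fin n) CQuat}
    (hX : ∀ a b, QuatMeasurable fun x => X x a b) : QuatMeasurable fun x => mooreDet (X x) := by
  unfold _root_.mooreDet
  refine QuatMeasurable.sum _ fun σ _ => ?_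
  simp_rw [zsmul_eq_mul]
  exact (QuatMeasurable.const _).mul
    (QuatMeasurable.listProd _ fun a => QuatMeasurable.listProd _ fun i => hX _ _)

theorem measurable_kernelDet_partialKernel {ι : Type*} {u : ι → Λ → CQuat}
    (hu : ∀ k, QuatMeasurable (u k)) (I : Finset ι) (m : ℕ) :
    Measurable fun x : Fin m → Λ => kernelDet (partialKernel u I) x :=
  Complex.measurable_re.comp (QuatMeasurable.mooreDet fun a b =>
    QuatMeasurable.sum I fun k _ => ((hu k).comp (measurable_pi_apply a)).mul
      ((hu k).comp (measurable_pi_apply b)).star).re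

theorem isDysonFamily_kernelDet {ι : Type*} [DecidableEq ι] {μ : Measure Λ}
    {u : ι → Λ → CQuat} (hu : IsOrthonormalSystem μ u) (I : Finset ι)
    (hpos : IsPositiveKernel (partialKernel u I)) :
    IsDysonFamily μ I.card (fun _ x => ENNReal.ofReal (kernelDet (partialKernel u I) x)) where
  measurable m := (measurable_kernelDet_partialKernel hu.measurable I m).ennreal_ofReal
  symm m σ x := by rw [kernelDet_comp_perm (isSelfDualKernel_partialKernel u I)]
  zero x := by
    change ENNReal.ofReal (mooreDet (kernelMatrix (partialKernel u I) x)).re.re = 1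
    rw [mooreDet_fin_zero]
    change ENNReal.ofReal (1 : ℂ).re = 1
    rw [Complex.one_re, ENNReal.ofReal_one]
  lintegral_cons m x := by
    obtain ⟨h1, h2⟩ := hu.integral_kernelDet_cons I x
    have hx := (hpos.mooreDet_eq x).1
    rw [← ofReal_integral_eq_lintegral_ofReal h1
      (Filter.Eventually.of_forall fun y => (hpos.mooreDet_eq _).1), h2]
    -- Once `m ≥ |I|`, the real factor `|I| - m` is nonpositive and `ENNReal.ofReal` sends the
    -- product to `0`, in agreement with the truncated subtraction.
    rcases le_total m I.card with h | h
    · rw [← Nat.cast_sub h, ENNReal.ofReal_mul (Nat.cast_nonneg _), ENNReal.ofReal_natCast]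
    · have h' : ((I.card : ℝ) - m) ≤ 0 := sub_nonpos.2 (Nat.cast_le.2 h)
      rw [ENNReal.ofReal_of_nonpos (mul_nonpos_of_nonpos_of_nonneg h' hx),
        Nat.sub_eq_zero_of_le h, Nat.cast_zero, zero_mul]

end KernelIntegration

/-! ### Bernoulli mixtures of projection kernels -/

section Mixture

/-- The probability that independent Bernoulli trials with parameters `c k` succeed exactly for
`k ∈ I`. -/
def bernoulliWeight {ι : Type*} [Fintype ι] [DecidableEq ι] (c : ι → ℝ) (I : Finset ι) : ℝ :=
  (∏ k ∈ I, c k) * ∏ k ∈ Finset.univ \ I, (1 - c k)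

theorem bernoulliWeight_nonneg {ι : Type*} [Fintype ι] [DecidableEq ι] {c : ι → ℝ}
    (hc : ∀ k, c k ∈ Set.Icc (0 : ℝ) 1) (I : Finset ι) : 0 ≤ bernoulliWeight c I :=
  mul_nonneg (Finset.prod_nonneg fun k _ => (hc k).1)
    (Finset.prod_nonneg fun k _ => sub_nonneg.2 (hc k).2)

theorem sum_bernoulliWeight {ι : Type*} [Fintype ι] [DecidableEq ι] (c : ι → ℝ) :
    ∑ I : Finset ι, bernoulliWeight c I = 1 := by
  have h := Finset.prod_add c (fun k => 1 - c k) Finset.univ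
  simp only [add_sub_cancel, Finset.prod_const_one, Finset.powerset_univ] at h
  exact h.symm

variable {Λ : Type*}

/-- The eigenvalue expansion at `Y = 0`; complete positivity makes every summand a real scalar. -/
theorem mooreDet_kernelMatrix_of_eq_sum {K : Λ → Λ → CQuat} {N : ℕ} {lam : Fin N → ℝ}
    {u : Fin N → Λ → CQuat}
    (hK : ∀ x y, K x y = ∑ k, (((lam k : ℂ)) : CQuat) * (u k x * star (u k y)))
    (hpos : IsCompletelyPositive u) {m : ℕ} (x : Fin m → Λ) :
    mooreDet (kernelMatrix K x) =
      (((∑ I, bernoulliWeight lam I * kernelDet (partialKernel u I) x : ℝ) : ℂ) : CQuat) := by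
  have h1 : kernelMatrix K x = 0 + ∑ k, (lam k : ℂ) • quatOuter (u k ∘ x) (u k ∘ x) := by
    ext1 a b
    rw [zero_add, Matrix.sum_apply]
    refine (hK _ _).trans (Finset.sum_congr rfl fun k _ => ?_)
    rw [CQuat.coe_mul]
    rfl
  have h0 : IsSelfDualKernel (0 : Matrix (Fin m) (Fin m) CQuat) := fun a b => by simp
  rw [h1, mooreDet_add_sum_smul_quatOuter _ _ _ h0, Finset.powerset_univ]
  have h2 : ∀ I : Finset (Fin N), ((∏ k ∈ I, (lam k : ℂ)) * ∏ k ∈ Finset.univ \ I,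
        (1 - (lam k : ℂ))) • mooreDet (0 + ∑ k ∈ I, quatOuter (u k ∘ x) (u k ∘ x)) =
      (((bernoulliWeight lam I * kernelDet (partialKernel u I) x : ℝ) : ℂ) : CQuat) := by
    intro I
    rw [zero_add, ← kernelMatrix_partialKernel, ((hpos I).mooreDet_eq x).2, ← CQuat.coe_mul,
      ← Quaternion.coe_mul]
    simp [bernoulliWeight]
  rw [Finset.sum_congr rfl fun I _ => h2 I]
  have := map_sum (algebraMap ℂ CQuat)
    (fun I : Finset (Fin N) => ((bernoulliWeight lam I * kernelDet (partialKernel u I) x : ℝ) : ℂ))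
    Finset.univ
  rw [Complex.ofReal_sum]
  exact this.symm

end Mixture

theorem theorem2 {Λ : Type*} [TopologicalSpace Λ] [MeasurableSpace Λ]
    (μ : Measure Λ) [SigmaFinite μ] (K : Λ → Λ → CQuat) {N : ℕ}
    (lam : Fin N → ℝ) (u : Fin N → Λ → CQuat)
    (hK : IsQuasiRealForm μ K lam u) (hpos : IsCompletelyPositive u)
    (hlam : ∀ k, lam k ∈ Set.Icc (0 : ℝ) 1) :
    DefinesPfaffianPointField μ K := by
  have hu := hK.orthonormal
  have hD := fun I => isDysonFamily_kernelDet hu I (hpos I)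
  choose P hPprob hP using fun I => (hD I).exists_pointField
  have hw := bernoulliWeight_nonneg hlam
  set w : Finset (Fin N) → ℝ≥0∞ := fun I => ENNReal.ofReal (bernoulliWeight lam I) with hw'
  -- Choose `I` by independent Bernoulli trials with parameters `lam k`, then sample the field of
  -- `partialKernel u I`.
  refine ⟨∑ I, w I • P I, ⟨?_⟩, ?_, ?_⟩
  · rw [Measure.finsetSum_apply]
    simp only [Measure.smul_apply, measure_univ, smul_eq_mul, mul_one, hw']
    rw [← ENNReal.ofReal_sum_of_nonneg fun I _ => hw I, sum_bernoulliWeight, ENNReal.ofReal_one]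
  · intro x y
    have h1 : ∀ k, ((lam k : ℂ) : CQuat) * (u k y * star (u k x)) =
        star (((lam k : ℂ) : CQuat) * (u k x * star (u k y))) := fun k => by
      rw [CQuat.coe_mul, CQuat.coe_mul, CQuat.star_smul, star_mul, star_star]
    have h2 := map_sum (starAddEquiv : CQuat ≃+ CQuat)
      (fun k => ((lam k : ℂ) : CQuat) * (u k x * star (u k y))) Finset.univ
    rw [hK.eq_sum, hK.eq_sum, Finset.sum_congr rfl fun k _ => h1 k]
    exact h2.symm
  · intro k _
    refine ⟨fun x => ∑ I, bernoulliWeight lam I * kernelDet (partialKernel u I) x, ?_,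
      fun x => mooreDet_kernelMatrix_of_eq_sum hK.eq_sum hpos x⟩
    have hnn : ∀ (I : Finset (Fin N)) (x : Fin k → Λ),
        0 ≤ bernoulliWeight lam I * kernelDet (partialKernel u I) x := fun I x =>
      mul_nonneg (hw I) ((hpos I).mooreDet_eq x).1
    have hint : ∀ I : Finset (Fin N), Integrable
        (fun x : Fin k → Λ => kernelDet (partialKernel u I) x) (Measure.pi fun _ => μ) := by
      intro I
      refine ⟨(measurable_kernelDet_partialKernel hu.measurable I k).aestronglyMeasurable, ?_⟩
      -- Dyson's relation gives the finite total integral `|I| (|I| - 1) ⋯ (|I| - k + 1)`.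
      -- Integrability is thus global, and local integrability needs no link between topology and
      -- measure.
      rw [hasFiniteIntegral_iff_ofReal
        (Filter.Eventually.of_forall fun x => ((hpos I).mooreDet_eq x).1), (hD I).lintegral_eq]
      exact ENNReal.natCast_lt_top _
    refine ⟨fun x => Finset.sum_nonneg fun I _ => hnn I x, ?_, ?_⟩
    · exact (integrable_finsetSum _ fun I _ => (hint I).const_mul _).locallyIntegrable
    · intro m A n hk hA hdis
      rw [lintegral_finsetSum_measure]
      simp_rw [lintegral_smul_measure, fun I => hP I k m A n hk hA hdis]
      have h3 : ∀ x : Fin k → Λ,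
          ENNReal.ofReal (∑ I, bernoulliWeight lam I * kernelDet (partialKernel u I) x) =
          ∑ I, w I * ENNReal.ofReal (kernelDet (partialKernel u I) x) := fun x => by
        rw [ENNReal.ofReal_sum_of_nonneg fun I _ => hnn I x]
        exact Finset.sum_congr rfl fun I _ => ENNReal.ofReal_mul (hw I)
      simp_rw [h3]
      rw [lintegral_finsetSum _ fun I _ => ((hD I).measurable k).const_mul _]
      refine Finset.sum_congr rfl fun I _ => ?_
      rw [lintegral_const_mul _ ((hD I).measurable k), smul_eq_mul]
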